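/- A word over a finite alphabet is square-free if it contains no factor of the form $xx$ with $x$ a nonempty word. An extension of a word $w$ over an alphabet $\Sigma$ is a word of the form $w'\ell w''$ with $\ell\in\Sigma$ and $w'w''=w$ (where $w'$ and $w''$ may be empty). A word $w$ over $\Sigma$ is extremal square-free if $w$ is square-free and no extension of $w$ is square-free. Let $n$ be a nonnegative integer. Then there is an extremal square-free word of length $n$ over the alphabet $\{a,b,c\}$ if and only if $$n\in\{25,41,48,50,63,71,72,77,79,81,83,84,85\}\cup\{m : m\ge 87\}.$$ -/

import Mathlib

/-- The three-letter alphabet `{a, b, c}`. -/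
inductive Letter where
  | a
  | b
  | c

/-- A word over `α` (a list of letters) is square-free if it has no factor of the form `x ++ x`
with `x` a nonempty word. -/
def SquareFreeWord {α : Type*} (w : List α) : Prop :=
  ∀ x : List α, x ≠ [] → ¬ (x ++ x) <:+: w

/-- `v` is an extension of `w`: it arises from `w` by inserting a single letter of the alphabet
at some position (beginning and end included). -/
def IsExtension {α : Type*} (v w : List α) : Prop :=
  ∃ (w₁ w₂ : List α) (l : α), w = w₁ ++ w₂ ∧ v = w₁ ++ [l] ++ w₂

/-- `w` is extremal square-free: it is square-free and has no square-free extension. -/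
def ExtremalSquareFree {α : Type*} (w : List α) : Prop :=
  SquareFreeWord w ∧ ∀ v : List α, IsExtension v w → ¬ SquareFreeWord v

/-! Lengths up to 86 are excluded by a search, the remaining lengths below 162 are realized by
explicit words, and all larger ones by a morphism.

Exclusion. The search runs through square-free prefixes. Suppose that the word continues after `m`
letters with one letter, while a second one could also be appended without a square. Inserting the
second letter at position `m` must create a square, and this square has to use letters after `m`.
Such obligations (pending gaps) are carried along, and a prefix is abandoned once one of them cannot
be met any more. The inserted letter lies in the first half (`First`) or in the second half
(`Second`) of its square. As an extension has at most 87 letters, periods are at most 43, so finite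
masks suffice. At the end of an extremal word no obligation is left and all three letters are
blocked. Soundness (`node_sound`, `fullSearch_sound`) is one-sided: each recorded obligation must be
genuine, whereas forgetting one merely enlarges the search. By renaming letters, the word may be
assumed to begin with `01`.

Existence. Short words are verified one by one (`Check.extremal_sound`). For `n ≥ 162` a morphism
`image` with blocks of length 41 is used. It preserves square-freeness (`squareFreeWord_image`), and
every gap at a block with a neighbour on each side is blocked (`blocked_image_three`), so only the
ends of `image v` need repair. There, caps are attached, which block their own gaps and those of the
adjoining block. A long square reaching into a cap would repeat a marker that occurs nowhere else,
and short squares are excluded by a finite check (`squareFreeWord_capped`,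
`extremalSquareFree_capped`). Pairs of the ten caps realize all residues modulo 41, and
`exists_squareFreeWord_with_ends` supplies `v` of any positive length with suitable ends. -/

/-! ### A search engine written for evaluation by the kernel

The state of the search is a prefix `w 0, …, w (m - 1)` of a ternary word. It is represented by
three bit masks (`d` is a bit of the mask of `c` when `w (m - d) = c`), by the list of *match masks*
(`d` is a bit of the `t`-th one when `w t = w (t - d)`), latest first, and by a list of *pending gaps*:
pairs of a position and a letter, the insertion of which has still to produce a square.
The functions below are in continuation passing style and use recursors only, every branch being a
short application, as this is what the kernel evaluates best. -/

namespace Search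

/-- Candidate squares through a gap: `cons (2 ^ d) t` asks for `w s = w (s - d)` up to `s = t`. -/
inductive Cand
  | nil
  | cons : ℕ → ℕ → Cand → Cand

/-- Pending gaps, with letter, time up to which no check for future candidates is needed, position.
A `bare` gap has no candidate, a `young` gap has a mask of candidate periods, and
a `full` gap has a list of candidates. -/
inductive Gaps
  | nil
  | bare : ℕ → ℕ → ℕ → Gaps → Gaps
  | young : ℕ → List ℕ → ℕ → ℕ → ℕ → Gaps → Gaps
  | full : Cand → ℕ → ℕ → ℕ → Gaps → Gaps

/-- Gaps that need a long period: `cons i (3 * i + l) p` says that the gap at position `i` with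
letter `l` needs a period that is at least `p`. -/
inductive Recs
  | nil
  | cons : ℕ → ℕ → ℕ → Recs → Recs

noncomputable section

def forceSucc (k : ℕ → Bool) (m : ℕ) (_ : Bool) : Bool := k (Nat.succ m)

/-- Call by value. -/
def force (k : ℕ → Bool) (n : ℕ) : Bool := Nat.rec (motive := fun _ => Bool) (k 0) (forceSucc k) n

/-! Periods of the suffixes: `p` is a bit of the first result when the last `p - 1` match masks have
it, and of the second one when the last `p - 2` match masks have it. -/

abbrev PeriodT := ℕ → ℕ → ℕ → ℕ → (ℕ → ℕ → Bool) → Bool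
def periodsTest (ih : PeriodT) (k Q P : ℕ) (K : ℕ → ℕ → Bool) (u : ℕ) (_ : Bool) : Bool :=
  ih (Nat.succ u) (Nat.mul 2 k) (Nat.lor Q (Nat.land (Nat.succ u) k)) P K
def periodsCons (e : ℕ) (_ : List ℕ) (ih : PeriodT) (U k Q P : ℕ) (K : ℕ → ℕ → Bool) : Bool :=
  Nat.rec (motive := fun _ => Bool) (K Q (Nat.lor P (Nat.land U k)))
    (periodsTest ih k Q (Nat.lor P (Nat.land U k)) K) (Nat.land U e)
def periodsNil (_ _ Q P : ℕ) (K : ℕ → ℕ → Bool) : Bool := K Q P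
def periods (es : List ℕ) : PeriodT :=
  List.rec (motive := fun _ => PeriodT) periodsNil periodsCons es

/-! Number of initial masks that have a given bit. -/

abbrev RunT := ℕ → (ℕ → Bool) → Bool
def runCons (pw : ℕ) (e : ℕ) (_ : List ℕ) (ih : RunT) (n : ℕ) (k : ℕ → Bool) : Bool :=
  Bool.rec (motive := fun _ => Bool) (ih (Nat.succ n) k) (k n) (Nat.beq (Nat.land e pw) 0)
def runNil (n : ℕ) (k : ℕ → Bool) : Bool := k n
def run (pw : ℕ) (es : List ℕ) : RunT := List.rec (motive := fun _ => RunT) runNil (runCons pw) es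

/-! Candidates that survive the mask `e` of the letter at position `m`; `kc` if one is completed. -/

def filterDone (m : ℕ) (kc : Bool) (pw tc : ℕ) (ih : Cand → Bool) (acc : Cand) : Bool :=
  Bool.rec (motive := fun _ => Bool) (ih (Cand.cons pw tc acc)) kc (Nat.ble tc m)
def filterCons (e m : ℕ) (kc : Bool) (pw tc : ℕ) (_ : Cand) (ih : Cand → Bool) (acc : Cand) :
    Bool :=
  Bool.rec (motive := fun _ => Bool) (filterDone m kc pw tc ih acc) (ih acc)
    (Nat.beq (Nat.land e pw) 0)
def filter (e m : ℕ) (kc : Bool) (K : Cand → Bool) (c : Cand) : Cand → Bool :=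
  Cand.rec (motive := fun _ => Cand → Bool) K (filterCons e m kc) c

/-! Can a square with the inserted letter in its first half still arise from letters after `m`?
The total length is at most 86. -/

abbrev FutureT := ℕ → ℕ → ℕ → ℕ → Bool
def futureNext (ih : FutureT) (U bit f : ℕ) (_ : Bool) : Bool := ih U 0 (Nat.mul bit 2) f
def futureSkip (ih : FutureT) (U bit fuel s : ℕ) (_ : Bool) : Bool := ih U s bit fuel
def futureTest (ih : FutureT) (bit fuel U : ℕ) : Bool :=
  Bool.rec (motive := fun _ => Bool) true
    (Nat.rec (motive := fun _ => Bool) false (futureNext ih U bit) fuel)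
    (Nat.beq (Nat.land U bit) 0)
def futureLive (ih : FutureT) (skip bit fuel u : ℕ) (_ : Bool) : Bool :=
  Nat.rec (motive := fun _ => Bool) (futureTest ih bit fuel (Nat.succ u))
    (futureSkip ih (Nat.succ u) bit fuel) skip
def futureCons (e : ℕ) (_ : List ℕ) (ih : FutureT) (U skip bit fuel : ℕ) : Bool :=
  Nat.rec (motive := fun _ => Bool) false (futureLive ih skip bit fuel) (Nat.land U e)
def futureNil (_ _ _ _ : ℕ) : Bool := true
def futureWalk (es : List ℕ) : FutureT :=
  List.rec (motive := fun _ => FutureT) futureNil futureCons es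
-- The period is `m + 2 - i + δ` with `δ ≥ 0`. As the square ends by position 85, at least `c + 2 *
-- δ` letters before the gap belong to it, where `c = 2 * (m + 1) - (i + 85)`, and `c + δ` of the
-- resulting equalities concern only letters up to position `m`. The fuel bounds `δ`: one has `c + 2
-- * δ ≤ i`, the gap position plus the period is at most 86, and the period is at most 43.
def futureLeft (es : List ℕ) (e i m c : ℕ) : Bool :=
  Bool.rec (motive := fun _ => Bool) false
    (futureWalk es e (Nat.pred c) (Nat.pow 2 (Nat.sub (Nat.succ m) i))
      (Nat.min (Nat.div (Nat.sub i c) 2) (Nat.min (Nat.sub 84 m) (Nat.sub 41 (Nat.sub m i)))))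
    (Nat.ble c i)
def future (m : ℕ) (es : List ℕ) (e i : ℕ) : Bool :=
  Bool.rec (motive := fun _ => Bool) false
    (force (futureLeft es e i m) (Nat.sub (Nat.mul 2 (Nat.succ m)) (Nat.add i 85)))
    (Nat.ble (Nat.sub (Nat.add m 2) i) 43)

/-! Keep a gap if it has candidates, now or in the future. Two gaps that need long periods exclude
each other. -/

abbrev GapsT := Gaps → Recs → Bool
def keepFuture (m e : ℕ) (es : List ℕ) (l i : ℕ) (acc : Gaps) (ih : GapsT) (R : Recs) : Bool :=
  Bool.rec (motive := fun _ => Bool)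
    (Bool.rec (motive := fun _ => Bool) true (ih (Gaps.bare l (Nat.succ m) i acc) R)
      (future m (List.cons e es) e i))
    (ih (Gaps.bare l (Nat.succ m) i acc) R)
    (Nat.ble (Nat.mul 2 (Nat.succ m)) (Nat.add i 85))
-- The inequality is the one of `First.false_of_long`, for lower bounds of the two periods.
def scanOther (i p i' key' p' : ℕ) (ih : Recs → Bool) (acc : Recs) : Bool :=
  Bool.rec (motive := fun _ => Bool) (ih (Recs.cons i' key' p' acc)) true
    (Nat.ble (Nat.add 44 (Nat.max i i')) (Nat.mul 2 (Nat.min p p')))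
def scanCons (i key p i' key' p' : ℕ) (_ : Recs) (ih : Recs → Bool) (acc : Recs) : Bool :=
  Bool.rec (motive := fun _ => Bool) (scanOther i p i' key' p' ih acc) (ih acc) (Nat.beq key key')
def scanNil (i key p : ℕ) (K : Recs → Bool) (acc : Recs) : Bool := K (Recs.cons i key p acc)
/-- Enter a gap into the list; `true` if it is incompatible with an entry. -/
def scan (i key p : ℕ) (K : Recs → Bool) (R : Recs) : Recs → Bool :=
  Recs.rec (motive := fun _ => Recs → Bool) (scanNil i key p K) (scanCons i key p) R
def keepLate (m e : ℕ) (es : List ℕ) (l i : ℕ) (acc : Gaps) (ih : GapsT) (R : Recs) : Bool :=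
  scan i (Nat.add (Nat.mul 3 i) l) (Nat.sub (Nat.add m 2) i) (keepFuture m e es l i acc ih) R
    Recs.nil
def keepBare (m e : ℕ) (es : List ℕ) (l T i : ℕ) (acc : Gaps) (ih : GapsT) (R : Recs) : Bool :=
  Bool.rec (motive := fun _ => Bool) (keepLate m e es l i acc ih R) (ih (Gaps.bare l T i acc) R)
    (Nat.ble m T)
def keepFull (l T i : ℕ) (acc : Gaps) (ih : GapsT) (R : Recs) (pw tc : ℕ) (r : Cand) (_ : Bool) :
    Bool :=
  ih (Gaps.full (Cand.cons pw tc r) l T i acc) R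
def keep (m e : ℕ) (es : List ℕ) (l T i : ℕ) (acc : Gaps) (ih : GapsT) (R : Recs) (ents : Cand) :
    Bool :=
  Cand.rec (motive := fun _ => Bool) (keepBare m e es l T i acc ih R) (keepFull l T i acc ih R) ents

/-! New candidate, when the inserted letter is the letter at position `m`. -/

def birthEntry (pd : ℕ) (K : Cand → Bool) (ents : Cand) (tc : ℕ) : Bool :=
  Bool.rec (motive := fun _ => Bool) (K ents)
    (force (fun pw => K (Cand.cons pw tc ents)) (Nat.mul 2 pd)) (Nat.ble tc 85)
-- The period is `d + 1`. If `L` letters before the gap match, then `d - L` letters after position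
-- `m` have to match, the last one being at `m + d - L`.
def birthRun (m d pd : ℕ) (kc : Bool) (K : Cand → Bool) (ents : Cand) (L : ℕ) : Bool :=
  Bool.rec (motive := fun _ => Bool) (force (birthEntry pd K ents) (Nat.sub (Nat.add m d) L)) kc
    (Nat.ble d L)
def birthPow (m : ℕ) (es : List ℕ) (kc : Bool) (K : Cand → Bool) (ents : Cand) (d pd : ℕ) : Bool :=
  run pd es 0 (birthRun m d pd kc K ents)
def birthDist (m : ℕ) (es : List ℕ) (kc : Bool) (K : Cand → Bool) (ents : Cand) (d : ℕ) : Bool :=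
  Bool.rec (motive := fun _ => Bool) (K ents) (force (birthPow m es kc K ents d) (Nat.pow 2 d))
    (Nat.ble d 42)
def birth (m : ℕ) (es : List ℕ) (i : ℕ) (kc : Bool) (K : Cand → Bool) (ents : Cand) : Bool :=
  force (birthDist m es kc K ents) (Nat.sub m i)
def birthIf (m c : ℕ) (es : List ℕ) (l i : ℕ) (kc : Bool) (K : Cand → Bool) (ents : Cand) : Bool :=
  Bool.rec (motive := fun _ => Bool) (K ents) (birth m es i kc K ents) (Nat.beq c l)

/-! Conversion of a mask of candidate periods to a list of candidates. -/

abbrev ConvT := ℕ → Cand → Bool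
-- The inserted letter separates the letters after the gap from their partners, so a square of
-- period `p` asks for agreement at distance `p - 1` in the word itself. Hence the division of `pw`
-- by 2.
def convEntry (m S pw : ℕ) (kc : Bool) (ih : ConvT) (acc : Cand) (tc : ℕ) : Bool :=
  Bool.rec (motive := fun _ => Bool)
    (Bool.rec (motive := fun _ => Bool) (ih (Nat.xor S pw) acc)
      (ih (Nat.xor S pw) (Cand.cons (Nat.div pw 2) tc acc)) (Nat.ble tc 85))
    kc (Nat.ble tc m)
def convRun (i m : ℕ) (kc : Bool) (ih : ConvT) (S : ℕ) (acc : Cand) (p pw L : ℕ) : Bool :=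
  force (convEntry m S pw kc ih acc) (Nat.sub (Nat.add i (Nat.sub p 2)) L)
def convPow (i m : ℕ) (esi : List ℕ) (kc : Bool) (ih : ConvT) (S : ℕ) (acc : Cand) (p pw : ℕ) :
    Bool :=
  run pw esi 0 (convRun i m kc ih S acc p pw)
def convBit (i m : ℕ) (esi : List ℕ) (kc : Bool) (ih : ConvT) (S : ℕ) (acc : Cand) (p : ℕ) : Bool :=
  force (convPow i m esi kc ih S acc p) (Nat.pow 2 p)
def convPos (i m : ℕ) (esi : List ℕ) (kc : Bool) (ih : ConvT) (acc : Cand) (s : ℕ) (_ : Bool) :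
    Bool :=
  force (convBit i m esi kc ih (Nat.succ s) acc) (Nat.log2 (Nat.succ s))
def convSucc (i m : ℕ) (esi : List ℕ) (kc : Bool) (K : Cand → Bool) (_ : ℕ) (ih : ConvT) (S : ℕ)
    (acc : Cand) : Bool :=
  Nat.rec (motive := fun _ => Bool) (K acc) (convPos i m esi kc ih acc) S
-- Masks have 44 bits and each step removes one. Running out of fuel would drop the gap, which is
-- sound as well.
def convZero (kc : Bool) (_ : ℕ) (_ : Cand) : Bool := kc
def conv (i m : ℕ) (esi : List ℕ) (kc : Bool) (K : Cand → Bool) : ConvT :=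
  Nat.rec (motive := fun _ => ConvT) (convZero kc) (convSucc i m esi kc K) 44

/-! Effect on the pending gaps of the letter `c` at position `m`. -/

def updBare (m c e : ℕ) (es : List ℕ) (l T i : ℕ) (_ : Gaps) (ih : GapsT) (acc : Gaps) (R : Recs) :
    Bool :=
  Bool.rec (motive := fun _ => Bool) (keepBare m e es l T i acc ih R)
    (birth m es i (ih acc R) (keep m e es l T i acc ih R) Cand.nil) (Nat.beq c l)
def updFull (m c e : ℕ) (es : List ℕ) (ents : Cand) (l T i : ℕ) (_ : Gaps) (ih : GapsT)
    (acc : Gaps) (R : Recs) : Bool :=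
  filter e m (ih acc R) (birthIf m c es l i (ih acc R) (keep m e es l T i acc ih R)) ents Cand.nil
def updPos (m c e : ℕ) (es : List ℕ) (esi : List ℕ) (l T i : ℕ) (ih : GapsT) (acc : Gaps)
    (R : Recs) (s : ℕ) (_ : Bool) : Bool :=
  conv i m esi (ih acc R) (birthIf m c es l i (ih acc R) (keep m e es l T i acc ih R)) (Nat.succ s)
    Cand.nil
def updYoung (m c e : ℕ) (es : List ℕ) (S : ℕ) (esi : List ℕ) (l T i : ℕ) (g : Gaps)
    (ih : GapsT) (acc : Gaps) (R : Recs) : Bool :=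
  Nat.rec (motive := fun _ => Bool) (updBare m c e es l T i g ih acc R)
    (updPos m c e es esi l T i ih acc R) (Nat.land S (Nat.mul 2 e))
def upd (m c e : ℕ) (es : List ℕ) (K : GapsT) (gs : Gaps) : GapsT :=
  Gaps.rec (motive := fun _ => GapsT) K (updBare m c e es) (updYoung m c e es) (updFull m c e es) gs

/-! The new gap at position `m` with letter `l`, `De` and `Dl` being the masks of the letter at
position `m` and of `l`, and `P` the second result of `periods`. -/

def newPos (P : ℕ) (es : List ℕ) (l T i : ℕ) (K : Gaps → Bool) (s : ℕ) (_ : Bool) : Bool :=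
  Bool.rec (motive := fun _ => Bool) (K Gaps.nil) (K (Gaps.young (Nat.succ s) es l T i Gaps.nil))
    (Nat.beq (Nat.land (Nat.succ s) P) 0)
def newMask (De Dl P : ℕ) (es : List ℕ) (l i : ℕ) (K : Gaps → Bool) (T : ℕ) : Bool :=
  Nat.rec (motive := fun _ => Bool) (K (Gaps.bare l T i Gaps.nil)) (newPos P es l T i K)
    (Nat.land Dl (Nat.mul 2 De))
-- The time bound only controls how often the tests for future squares are made; every value is
-- sound.
def newGap (m l De Dl P : ℕ) (es : List ℕ) (K : Gaps → Bool) : Bool :=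
  force (newMask De Dl P es l m K)
    (Nat.min (Nat.add (Nat.add m 19) (Nat.div (Nat.succ m) 2)) (Nat.sub (Nat.div (Nat.add m 85) 2) 1))

/-! The children of a node: `child01` appends the letter `0` and opens a gap with the letter `1`. -/

abbrev NodeT := List ℕ → ℕ → ℕ → ℕ → Gaps → Recs → Bool
abbrev ChildT := ℕ → NodeT → List ℕ → ℕ → ℕ → ℕ → Gaps → Recs → ℕ → Bool

/-- Mask of a letter after another letter is appended. -/
def shift (x : ℕ) : ℕ := Nat.mod (Nat.mul 2 x) 17592186044416
/-- Mask of a letter after it is appended. -/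
def shiftSucc (x : ℕ) : ℕ := Nat.mod (Nat.mul 2 (Nat.succ x)) 17592186044416

def next0 (ih : NodeT) (es : List ℕ) (a b c : ℕ) : GapsT :=
  ih (List.cons a es) (shiftSucc a) (shift b) (shift c)
def next1 (ih : NodeT) (es : List ℕ) (a b c : ℕ) : GapsT :=
  ih (List.cons b es) (shift a) (shiftSucc b) (shift c)
def next2 (ih : NodeT) (es : List ℕ) (a b c : ℕ) : GapsT :=
  ih (List.cons c es) (shift a) (shift b) (shiftSucc c)
def append (m c e : ℕ) (es : List ℕ) (K : GapsT) (gs : Gaps) (R : Recs) (acc : Gaps) : Bool :=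
  upd m c e es K gs acc R
def child0 : ChildT := fun m ih es a b c gs R _ =>
  upd m 0 a es (next0 ih es a b c) gs Gaps.nil R
def child1 : ChildT := fun m ih es a b c gs R _ =>
  upd m 1 b es (next1 ih es a b c) gs Gaps.nil R
def child2 : ChildT := fun m ih es a b c gs R _ =>
  upd m 2 c es (next2 ih es a b c) gs Gaps.nil R
def child01 : ChildT := fun m ih es a b c gs R P =>
  newGap m 1 a b P es (append m 0 a es (next0 ih es a b c) gs R)
def child02 : ChildT := fun m ih es a b c gs R P =>
  newGap m 2 a c P es (append m 0 a es (next0 ih es a b c) gs R)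
def child10 : ChildT := fun m ih es a b c gs R P =>
  newGap m 0 b a P es (append m 1 b es (next1 ih es a b c) gs R)
def child12 : ChildT := fun m ih es a b c gs R P =>
  newGap m 2 b c P es (append m 1 b es (next1 ih es a b c) gs R)
def child20 : ChildT := fun m ih es a b c gs R P =>
  newGap m 0 c a P es (append m 2 c es (next2 ih es a b c) gs R)
def child21 : ChildT := fun m ih es a b c gs R P =>
  newGap m 1 c b P es (append m 2 c es (next2 ih es a b c) gs R)

/-! Selection of the children, given for each letter whether it can be appended. -/

def context (m : ℕ) (ih : NodeT) (es : List ℕ) (a b c : ℕ) (gs : Gaps) (R : Recs) (P : ℕ)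
    (h : ChildT) : Bool :=
  h m ih es a b c gs R P
def select00 (X : ChildT → Bool) (tc lf : Bool) : Bool :=
  Bool.rec (motive := fun _ => Bool) lf (X child2) tc
def select01 (X : ChildT → Bool) (tc : Bool) : Bool :=
  Bool.rec (motive := fun _ => Bool) (X child1) (Bool.and (X child12) (X child21)) tc
def select10 (X : ChildT → Bool) (tc : Bool) : Bool :=
  Bool.rec (motive := fun _ => Bool) (X child0) (Bool.and (X child02) (X child20)) tc
-- After a nonempty prefix the last letter cannot be appended, so three free letters never occur;
-- the value `false` claims nothing.
def select11 (X : ChildT → Bool) (tc : Bool) : Bool :=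
  Bool.rec (motive := fun _ => Bool) (Bool.and (X child01) (X child10)) false tc
def select0 (X : ChildT → Bool) (tb tc lf : Bool) : Bool :=
  Bool.rec (motive := fun _ => Bool) (select00 X tc lf) (select01 X tc) tb
def select1 (X : ChildT → Bool) (tb tc : Bool) : Bool :=
  Bool.rec (motive := fun _ => Bool) (select10 X tc) (select11 X tc) tb
def select (X : ChildT → Bool) (ta tb tc lf : Bool) : Bool :=
  Bool.rec (motive := fun _ => Bool) (select0 X tb tc lf) (select1 X tb tc) ta

/-- The lengths up to 86 of extremal words. -/
def isLength (m : ℕ) : Bool :=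
  [25, 41, 48, 50, 63, 71, 72, 77, 79, 81, 83, 84, 85].contains m

def leafBare (_ _ _ : ℕ) (_ : Gaps) (_ : Bool) : Bool := true
def leafYoung (_ : ℕ) (_ : List ℕ) (_ _ _ : ℕ) (_ : Gaps) (_ : Bool) : Bool := true
def leafFull (_ : Cand) (_ _ _ : ℕ) (_ : Gaps) (_ : Bool) : Bool := true
/-- Is a word of length `m` that cannot be prolonged harmless? -/
def leaf (m : ℕ) (gs : Gaps) : Bool :=
  Gaps.rec (motive := fun _ => Bool) (isLength m) leafBare leafYoung leafFull gs

def nodePeriods (m : ℕ) (ih : NodeT) (es : List ℕ) (a b c : ℕ) (gs : Gaps) (R : Recs) (Q P : ℕ) :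
    Bool :=
  select (context m ih es a b c gs R P) (Nat.beq (Nat.land a Q) 0) (Nat.beq (Nat.land b Q) 0)
    (Nat.beq (Nat.land c Q) 0) (leaf m gs)
def nodeC (m : ℕ) (ih : NodeT) (es : List ℕ) (gs : Gaps) (R : Recs) (a b c : ℕ) : Bool :=
  periods es 17592186044415 4 2 0 (nodePeriods m ih es a b c gs R)
def nodeB (m : ℕ) (ih : NodeT) (es : List ℕ) (c : ℕ) (gs : Gaps) (R : Recs) (a b : ℕ) : Bool :=
  force (nodeC m ih es gs R a b) c
def nodeA (m : ℕ) (ih : NodeT) (es : List ℕ) (b c : ℕ) (gs : Gaps) (R : Recs) (a : ℕ) : Bool :=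
  force (nodeB m ih es c gs R a) b
def node (N f : ℕ) (ih : NodeT) (es : List ℕ) (a b c : ℕ) (gs : Gaps) (R : Recs) : Bool :=
  force (nodeA (Nat.sub N f) ih es b c gs R) a

/-- The search from depth `N + 1 - fuel` to depth `N + 1`, where `base` is used. -/
def search (N : ℕ) (base : NodeT) (fuel : ℕ) : NodeT :=
  Nat.rec (motive := fun _ => NodeT) base (node N) fuel

/-- Used at depth 87, which no word of length at most 86 reaches. -/
def endNode : NodeT := fun _ _ _ _ _ _ => true

/-- The search from depth 19, for those prefixes for which the mask of `0` is `r` modulo `k`. -/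
def deepSearch (k r : ℕ) : NodeT := fun es a b c gs R =>
  Bool.rec (motive := fun _ => Bool) true (search 86 endNode 68 es a b c gs R)
    (Nat.beq (Nat.mod a k) r)

/-- The search for the words that begin with `01`. -/
def fullSearch (k r : ℕ) : Bool :=
  -- The data describe the prefix `0`. Inserting `1` or `2` in front of it leaves two pending gaps,
  -- while inserting `0` gives the square `00`.
  child12 1 (search 18 (deepSearch k r) 17) [0] 2 0 0
    (Gaps.bare 1 19 0 (Gaps.bare 2 19 0 Gaps.nil)) Recs.nil 0

end

end Search

/-! ### Soundness of the search -/

namespace Search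

/-- Mask of the distances from `m` to earlier letters `c`. -/
noncomputable def mask (w : ℕ → ℕ) (c : ℕ) : ℕ → ℕ
  | 0 => 0
  | m + 1 => if w m = c then shiftSucc (mask w c m) else shift (mask w c m)

/-- Mask of the distances from `t` to earlier letters that are equal to `w t`. -/
noncomputable def matchMask (w : ℕ → ℕ) (t : ℕ) : ℕ := mask w (w t) t

noncomputable def masks (w : ℕ → ℕ) : ℕ → List ℕ
  | 0 => []
  | m + 1 => matchMask w m :: masks w m

theorem force_eq (k : ℕ → Bool) (n : ℕ) : force k n = k n := by
  cases n <;> rfl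

theorem of_rec_beq {x y : Bool} {a b : ℕ}
    (h : Bool.rec (motive := fun _ => Bool) x y (Nat.beq a b) = true) :
    (a = b ∧ y = true) ∨ (a ≠ b ∧ x = true) := by
  by_cases hab : a = b
  · subst hab; exact Or.inl ⟨rfl, by simpa using h⟩
  · have : Nat.beq a b = false := by
      rw [← Bool.not_eq_true, Nat.beq_eq]; exact hab
    rw [this] at h
    exact Or.inr ⟨hab, h⟩

theorem of_rec_ble {x y : Bool} {a b : ℕ}
    (h : Bool.rec (motive := fun _ => Bool) x y (Nat.ble a b) = true) :
    (a ≤ b ∧ y = true) ∨ (¬ a ≤ b ∧ x = true) := by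
  by_cases hab : a ≤ b
  · rw [Nat.ble_eq_true_of_le hab] at h; exact Or.inl ⟨hab, h⟩
  · have : Nat.ble a b = false := by
      rw [← Bool.not_eq_true, Nat.ble_eq]; exact hab
    rw [this] at h
    exact Or.inr ⟨hab, h⟩

theorem land_two_pow_eq_zero (e d : ℕ) : Nat.land e (2 ^ d) = 0 ↔ e.testBit d = false := by
  change e &&& 2 ^ d = 0 ↔ _
  rw [Nat.and_two_pow]
  cases e.testBit d <;> simp

theorem testBit_two_mul (x d : ℕ) : (2 * x).testBit (d + 1) = x.testBit d := by
  rw [Nat.testBit_succ]; simp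

theorem testBit_shift (x d : ℕ) :
    (shift x).testBit (d + 1) = (decide (d < 43) && x.testBit d) := by
  change (2 * x % 2 ^ 44).testBit (d + 1) = _
  rw [Nat.testBit_mod_two_pow, testBit_two_mul]
  congr 1
  simp only [decide_eq_decide]; omega

theorem testBit_shift_zero (x : ℕ) : (shift x).testBit 0 = false := by
  change (2 * x % 2 ^ 44).testBit 0 = _
  rw [Nat.testBit_mod_two_pow]
  simp

theorem testBit_shiftSucc (x d : ℕ) (hx : x.testBit 0 = false) :
    (shiftSucc x).testBit (d + 1) = (decide (d < 43) && (decide (d = 0) || x.testBit d)) := by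
  change (2 * (x + 1) % 2 ^ 44).testBit (d + 1) = _
  rw [Nat.testBit_mod_two_pow, testBit_two_mul]
  have hx2 : x % 2 = 0 := by simpa using hx
  congr 1
  · simp only [decide_eq_decide]; omega
  · cases d with
    | zero => simp; omega
    | succ d =>
      rw [Nat.testBit_succ, Nat.testBit_succ]
      have : (x + 1) / 2 = x / 2 := by omega
      simp [this]

theorem testBit_shiftSucc_zero (x : ℕ) : (shiftSucc x).testBit 0 = false := by
  change (2 * (x + 1) % 2 ^ 44).testBit 0 = _
  rw [Nat.testBit_mod_two_pow]
  simp

theorem testBit_mask_zero (w : ℕ → ℕ) (c m : ℕ) : (mask w c m).testBit 0 = false := by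
  cases m with
  | zero => simp [mask]
  | succ m =>
    rw [mask]
    split
    · exact testBit_shiftSucc_zero _
    · exact testBit_shift_zero _

theorem testBit_mask (w : ℕ → ℕ) (c m d : ℕ) :
    (mask w c m).testBit d = true ↔ 1 ≤ d ∧ d ≤ m ∧ d ≤ 43 ∧ w (m - d) = c := by
  induction m generalizing d with
  | zero => simp [mask]; omega
  | succ m ih =>
    cases d with
    | zero => rw [testBit_mask_zero]; simp
    | succ d =>
      rw [mask]
      have e : m + 1 - (d + 1) = m - d := by omega
      rw [e]
      split
      · next h =>
        rw [testBit_shiftSucc _ _ (testBit_mask_zero w c m)]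
        by_cases hd : d = 0
        · subst hd; simp [h]
        · simp only [hd, decide_false, Bool.false_or, Bool.and_eq_true, decide_eq_true_eq, ih]
          constructor
          · rintro ⟨h1, h2, h3, h4, h5⟩; exact ⟨by omega, by omega, by omega, h5⟩
          · rintro ⟨h1, h2, h3, h4⟩; exact ⟨by omega, by omega, by omega, by omega, h4⟩
      · next h =>
        rw [testBit_shift]
        simp only [Bool.and_eq_true, decide_eq_true_eq, ih]
        constructor
        · rintro ⟨h1, h2, h3, h4, h5⟩; exact ⟨by omega, by omega, by omega, h5⟩
        · rintro ⟨h1, h2, h3, h4⟩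
          have : d ≠ 0 := by rintro rfl; exact h (by simpa using h4)
          exact ⟨by omega, by omega, by omega, by omega, h4⟩

theorem testBit_matchMask (w : ℕ → ℕ) (t d : ℕ) :
    (matchMask w t).testBit d = true ↔ 1 ≤ d ∧ d ≤ t ∧ d ≤ 43 ∧ w (t - d) = w t :=
  testBit_mask w _ t d

theorem getD_masks (w : ℕ → ℕ) (m x : ℕ) (h : x < m) :
    (masks w m).getD x 0 = matchMask w (m - 1 - x) := by
  induction m generalizing x with
  | zero => omega
  | succ m ih =>
    cases x with
    | zero => simp [masks]
    | succ x =>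
      rw [masks, List.getD_cons_succ, ih x (by omega)]
      congr 1; omega

theorem length_masks (w : ℕ → ℕ) (m : ℕ) : (masks w m).length = m := by
  induction m with
  | zero => rfl
  | succ m ih => simp [masks, ih]

theorem testBit_getD_masks (w : ℕ → ℕ) (m x d : ℕ) :
    ((masks w m).getD x 0).testBit d = true ↔
      1 ≤ d ∧ d ≤ 43 ∧ d + x + 1 ≤ m ∧ w (m - 1 - x - d) = w (m - 1 - x) := by
  by_cases h : x < m
  · rw [getD_masks w m x h, testBit_matchMask]
    constructor
    · rintro ⟨h1, h2, h3, h4⟩; exact ⟨h1, h3, by omega, h4⟩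
    · rintro ⟨h1, h2, h3, h4⟩; exact ⟨h1, by omega, h2, h4⟩
  · rw [List.getD_eq_default _ _ (by rw [length_masks]; omega)]
    simp; omega

/-! #### Periods of the suffixes -/

/-- `U` retains the distances common to all masks read so far. The first result decides which
letters are blocked and is needed as an equivalence. For the second, one implication is enough,
since a superfluous bit only drops a gap. -/
theorem periods_sound (es : List ℕ) (K : ℕ → ℕ → Bool) :
    ∀ U b Q P, periods es U (2 ^ b) Q P K = true → ∃ Q' P', K Q' P' = true ∧
      (∀ q, Q'.testBit q = true ↔ Q.testBit q = true ∨
        (b ≤ q ∧ U.testBit q = true ∧ ∀ x ≤ q - b, (es.getD x 0).testBit q = true)) ∧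
      (∀ q, (P.testBit q = true ∨
        (b ≤ q ∧ U.testBit q = true ∧ q - b < es.length ∧
          ∀ x < q - b, (es.getD x 0).testBit q = true)) → P'.testBit q = true) := by
  induction es with
  | nil =>
    intro U b Q P h
    refine ⟨Q, P, h, fun q => ⟨Or.inl, ?_⟩, fun q => ?_⟩
    · rintro (h | ⟨_, _, h⟩)
      · exact h
      · simpa using h 0 (by omega)
    · rintro (h | ⟨_, _, h, _⟩)
      · exact h
      · simp at h
  | cons e es ih =>
    intro U b Q P h
    have hP : ∀ q, (Nat.lor P (Nat.land U (2 ^ b))).testBit q = true ↔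
        P.testBit q = true ∨ (q = b ∧ U.testBit q = true) := by
      intro q
      change (P ||| U &&& 2 ^ b).testBit q = true ↔ _
      rw [Nat.testBit_or, Nat.testBit_and, Nat.testBit_two_pow]
      simp only [Bool.or_eq_true, Bool.and_eq_true, decide_eq_true_eq]
      rw [and_comm]
      constructor <;> rintro (h0 | ⟨h0, h1⟩)
      · exact Or.inl h0
      · exact Or.inr ⟨h0.symm, h1⟩
      · exact Or.inl h0
      · exact Or.inr ⟨h0.symm, h1⟩
    have hU : ∀ q, (Nat.land U e).testBit q = true ↔ U.testBit q = true ∧ e.testBit q = true := by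
      intro q
      change (U &&& e).testBit q = true ↔ _
      rw [Nat.testBit_and, Bool.and_eq_true]
    change Nat.rec (motive := fun _ => Bool) (K Q (Nat.lor P (Nat.land U (2 ^ b))))
      (periodsTest (periods es) (2 ^ b) Q (Nat.lor P (Nat.land U (2 ^ b))) K) (Nat.land U e)
      = true at h
    rcases hu : Nat.land U e with _ | u
    · rw [hu] at h
      refine ⟨_, _, h, fun q => ⟨Or.inl, ?_⟩, fun q => ?_⟩
      · rintro (h | ⟨_, h1, h2⟩)
        · exact h
        · have := (hU q).2 ⟨h1, by simpa using h2 0 (by omega)⟩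
          rw [hu] at this; simp at this
      · rw [hP]
        rintro (h | ⟨h0, h1, _, h2⟩)
        · exact Or.inl h
        · by_cases hq : q = b
          · exact Or.inr ⟨hq, h1⟩
          · have := (hU q).2 ⟨h1, by simpa using h2 0 (by omega)⟩
            rw [hu] at this; simp at this
    · rw [hu] at h
      change periods es (u + 1) (Nat.mul 2 (2 ^ b)) (Nat.lor Q (Nat.land (u + 1) (2 ^ b)))
        (Nat.lor P (Nat.land U (2 ^ b))) K = true at h
      have e2 : Nat.mul 2 (2 ^ b) = 2 ^ (b + 1) := by
        change 2 * 2 ^ b = _; rw [pow_succ, mul_comm]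
      rw [e2] at h
      obtain ⟨Q', P', hK, h1, h2⟩ := ih _ _ _ _ h
      refine ⟨Q', P', hK, fun q => ?_, fun q hq => h2 q ?_⟩
      · rw [h1]
        have hQ : (Nat.lor Q (Nat.land (u + 1) (2 ^ b))).testBit q = true ↔
            Q.testBit q = true ∨ (q = b ∧ (u + 1).testBit q = true) := by
          change (Q ||| (u + 1) &&& 2 ^ b).testBit q = true ↔ _
          rw [Nat.testBit_or, Nat.testBit_and, Nat.testBit_two_pow]
          simp only [Bool.or_eq_true, Bool.and_eq_true, decide_eq_true_eq]
          rw [and_comm]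
          constructor <;> rintro (h0 | ⟨h0, h1⟩)
          · exact Or.inl h0
          · exact Or.inr ⟨h0.symm, h1⟩
          · exact Or.inl h0
          · exact Or.inr ⟨h0.symm, h1⟩
        rw [hQ, ← hu, hU]
        constructor
        · rintro ((h | ⟨rfl, h, h'⟩) | ⟨hb, ⟨h, h'⟩, h''⟩)
          · exact Or.inl h
          · refine Or.inr ⟨le_rfl, h, fun x hx => ?_⟩
            obtain rfl : x = 0 := by omega
            simpa using h'
          · refine Or.inr ⟨by omega, h, fun x hx => ?_⟩
            cases x with
            | zero => simpa using h'
            | succ x => rw [List.getD_cons_succ]; exact h'' x (by omega)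
        · rintro (h | ⟨hb, h, h'⟩)
          · exact Or.inl (Or.inl h)
          · have h0 : e.testBit q = true := by simpa using h' 0 (by omega)
            by_cases hq : q = b
            · exact Or.inl (Or.inr ⟨hq, h, h0⟩)
            · refine Or.inr ⟨by omega, ⟨h, h0⟩, fun x hx => ?_⟩
              have := h' (x + 1) (by omega)
              rwa [List.getD_cons_succ] at this
      · rw [hP, ← hu, hU]
        rcases hq with h | ⟨hb, h, hl, h'⟩
        · exact Or.inl (Or.inl h)
        · by_cases hq : q = b
          · exact Or.inl (Or.inr ⟨hq, h⟩)
          · have h0 : e.testBit q = true := by simpa using h' 0 (by omega)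
            refine Or.inr ⟨by omega, ⟨h, h0⟩, ?_, fun x hx => ?_⟩
            · simp at hl; omega
            · have := h' (x + 1) (by omega)
              rwa [List.getD_cons_succ] at this

/-! #### Runs -/

/-- An upper bound for the length of a run suffices: overestimating it makes a candidate ask for
fewer agreements. -/
theorem run_sound (d : ℕ) (es : List ℕ) (k : ℕ → Bool) :
    ∀ a, run (2 ^ d) es a k = true → ∃ r, k (a + r) = true ∧
      ∀ L, (∀ x < L, (es.getD x 0).testBit d = true) → L ≤ r := by
  induction es with
  | nil =>
    intro a h
    refine ⟨0, h, fun L hL => ?_⟩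
    by_contra hc
    have := hL 0 (by omega)
    simp at this
  | cons e es ih =>
    intro a h
    change Bool.rec (motive := fun _ => Bool) (run (2 ^ d) es (a + 1) k) (k a)
      (Nat.beq (Nat.land e (2 ^ d)) 0) = true at h
    rcases of_rec_beq h with ⟨he, h⟩ | ⟨_, h⟩
    · rw [land_two_pow_eq_zero] at he
      refine ⟨0, h, fun L hL => ?_⟩
      by_contra hc
      have := hL 0 (by omega)
      simp [he] at this
    · obtain ⟨r, hr, hL⟩ := ih _ h
      refine ⟨r + 1, by rwa [← add_assoc, add_right_comm], fun L h => ?_⟩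
      cases L with
      | zero => omega
      | succ L =>
        have := hL L fun x hx => by
          have := h (x + 1) (by omega)
          rwa [List.getD_cons_succ] at this
        omega

end Search

/-! ### Squares created by an insertion -/

namespace Search

/-- The insertion of `l` at position `i` into the word `w 0, …, w (n - 1)` creates a square of period
`p` with the inserted letter in its first half. -/
def First (w : ℕ → ℕ) (n i l p : ℕ) : Prop :=
  ∃ L R, L + R + 1 = p ∧ L ≤ i ∧ i + p + R ≤ n ∧ w (i + p - 1) = l ∧
    (∀ r < R, w (i + r) = w (i + p + r)) ∧ ∀ x < L, w (i - 1 - x) = w (i + p - 2 - x)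

/-- The insertion of `l` at position `i` into the word `w 0, …, w (n - 1)` creates a square of period
`p` with the inserted letter in its second half, followed by `R` letters. -/
def Second (w : ℕ → ℕ) (n i l p R : ℕ) : Prop :=
  ∃ L, L + R + 1 = p ∧ L + p ≤ i ∧ i + R ≤ n ∧ w (i - p) = l ∧
    (∀ r < R, w (i + r) = w (i - p + 1 + r)) ∧ ∀ x < L, w (i - 1 - x) = w (i - p - 1 - x)

/-- `w 0, …, w (n - 1)` is a square-free word in the letters `0, 1, 2`, of length at most 86, that
has no square-free extension. -/
structure Extremal (w : ℕ → ℕ) (n : ℕ) : Prop where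
  lt : ∀ t, w t < 3
  le : n ≤ 86
  squareFree : ∀ s p, 0 < p → s + 2 * p ≤ n → ∃ t < p, w (s + t) ≠ w (s + t + p)
  gap : ∀ i ≤ n, ∀ l < 3, ∃ p ≤ 43, First w n i l p ∨ ∃ R, Second w n i l p R

/-- The square that is created uses letters after position `m`, with the inserted letter in its
first half. -/
def Late (w : ℕ → ℕ) (n i l m : ℕ) : Prop :=
  ∃ p ≤ 43, First w n i l p ∧ m < i + p

theorem First.adjacent_ne {w : ℕ → ℕ} {n : ℕ} (hw : Extremal w n) {s : ℕ} (h : s + 2 ≤ n) :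
    w s ≠ w (s + 1) := by
  obtain ⟨t, ht, h⟩ := hw.squareFree s 1 one_pos h
  obtain rfl : t = 0 := by omega
  exact h

/-- The long periods leave long parts after the gaps, which overlap from `y` on. Different periods
then yield a square whose period is their difference. Equal periods force `l = l'` if `x = y`, and
otherwise a square of period `p` or two equal adjacent letters. -/
theorem First.false_of_long {w : ℕ → ℕ} {n x l y l' p p' : ℕ} (hw : Extremal w n)
    (h : First w n x l p) (h' : First w n y l' p') (hxy : x ≤ y) (hne : x = y → l ≠ l')
    (hp : p ≤ 43) (hp' : p' ≤ 43) (hl : 44 + y ≤ 2 * p) (hl' : 44 + y ≤ 2 * p') : False := by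
  obtain ⟨L, R, e, hL, hn, hlast, hR, hLe⟩ := h
  obtain ⟨L', R', e', hL', hn', hlast', hR', hLe'⟩ := h'
  -- overlapping ranges with both shifts
  rcases lt_trichotomy p p' with hlt | rfl | hlt
  · obtain ⟨t, ht, h⟩ := hw.squareFree (y + p) (p' - p) (by omega) (by omega)
    apply h
    have h1 := hR (y - x + t) (by omega)
    have h2 := hR' t (by omega)
    rw [show x + (y - x + t) = y + t by omega, show x + p + (y - x + t) = y + p + t by omega] at h1
    rw [show y + p + t + (p' - p) = y + p' + t by omega, ← h1, ← h2]
  · rcases eq_or_lt_of_le hxy with rfl | hlt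
    · exact hne rfl (hlast ▸ hlast'.symm ▸ rfl)
    · have h1 := hR (y - 1 - x) (by omega)
      rw [show x + (y - 1 - x) = y - 1 by omega,
        show x + p + (y - 1 - x) = y + p - 1 by omega] at h1
      by_cases hL0 : L' = 0
      · obtain ⟨t, ht, h⟩ := hw.squareFree (y - 1) p (by omega) (by omega)
        apply h
        cases t with
        | zero =>
          rw [add_zero, h1]; congr 1; omega
        | succ t =>
          have := hR' t (by omega)
          rw [show y - 1 + (t + 1) = y + t by omega, this]; congr 1; omega
      · have h2 := hLe' 0 (by omega)
        apply First.adjacent_ne hw (s := y + p - 2) (by omega)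
        rw [Nat.sub_zero, Nat.sub_zero] at h2
        rw [← h2, h1]; congr 1; omega
  · obtain ⟨t, ht, h⟩ := hw.squareFree (y + p') (p - p') (by omega) (by omega)
    apply h
    have h1 := hR (y - x + t) (by omega)
    have h2 := hR' t (by omega)
    rw [show x + (y - x + t) = y + t by omega, show x + p + (y - x + t) = y + p + t by omega] at h1
    rw [show y + p' + t + (p - p') = y + p + t by omega, ← h1, ← h2]

/-! #### Candidates -/

/-- The candidate comes from a square through the gap. -/
def EntryOK (w : ℕ → ℕ) (n m pw tc : ℕ) : Prop :=
  ∃ d, pw = 2 ^ d ∧ 1 ≤ d ∧ d ≤ 43 ∧ m ≤ tc ∧ tc < n ∧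
    ∀ t, m ≤ t → t ≤ tc → d ≤ t ∧ w (t - d) = w t

/-- Some candidate comes from a square through the gap. -/
def Cand.OK (w : ℕ → ℕ) (n m : ℕ) : Cand → Prop
  | .nil => False
  | .cons pw tc c => EntryOK w n m pw tc ∨ c.OK w n m

/-- Pattern of all soundness lemmas in continuation passing style: `G` is the final goal, reached
whenever a continuation returns `true` on truthful data. `X` is the alternative that the square is
not among the candidates. -/
theorem filter_sound {w : ℕ → ℕ} {n m : ℕ} {kc : Bool} {K : Cand → Bool} {G X : Prop}
    (hkc : kc = true → G)
    (hK : ∀ ents : Cand, ents.OK w n (m + 1) ∨ X → K ents = true → G) (c : Cand) :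
    ∀ acc : Cand, c.OK w n m ∨ acc.OK w n (m + 1) ∨ X →
      filter (matchMask w m) m kc K c acc = true → G := by
  induction c with
  | nil =>
    rintro acc (h | h) hf
    · exact h.elim
    · exact hK acc h hf
  | cons pw tc c ih =>
    intro acc h hf
    change Bool.rec (motive := fun _ => Bool)
      (filterDone m kc pw tc (filter (matchMask w m) m kc K c) acc)
      (filter (matchMask w m) m kc K c acc) (Nat.beq (Nat.land (matchMask w m) pw) 0) = true at hf
    rcases of_rec_beq hf with ⟨h0, hf⟩ | ⟨h0, hf⟩
    · refine ih acc ?_ hf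
      rcases h with (⟨d, rfl, h1, h2, h3, h4, h5⟩ | h) | h
      · rw [land_two_pow_eq_zero] at h0
        obtain ⟨h6, h7⟩ := h5 m le_rfl h3
        rw [(testBit_matchMask w m d).2 ⟨h1, h6, h2, h7⟩] at h0
        simp at h0
      · exact Or.inl h
      · exact Or.inr h
    · rcases of_rec_ble hf with ⟨_, hf⟩ | ⟨h1, hf⟩
      · exact hkc hf
      · refine ih _ ?_ hf
        rcases h with (⟨d, h1, h2, h3, h4, h5, h6⟩ | h) | h | h
        · exact Or.inr (Or.inl (Or.inl ⟨d, h1, h2, h3, by omega, h5,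
            fun t ht => h6 t (by omega)⟩))
        · exact Or.inl h
        · exact Or.inr (Or.inl (Or.inr h))
        · exact Or.inr (Or.inr h)

/-- With period `m + 1 - i`, position `m` is the partner of the inserted letter. In `w`, the parts
preceding the two partners agree at distance `m - i`, since the insertion adds one, and the parts
following them at distance `m + 1 - i`. -/
theorem birth_sound {w : ℕ → ℕ} {n m i l : ℕ} {kc : Bool} {K : Cand → Bool} {G X : Prop}
    (hn : n ≤ 86) (hi : i < m)
    (hkc : kc = true → G)
    (hK : ∀ ents : Cand, ents.OK w n (m + 1) ∨ X → K ents = true → G) (ents : Cand)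
    (h : ents.OK w n (m + 1) ∨ (m + 1 - i ≤ 43 ∧ First w n i l (m + 1 - i)) ∨ X)
    (hf : birth m (masks w m) i kc K ents = true) : G := by
  rw [birth, force_eq] at hf
  change birthDist m (masks w m) kc K ents (m - i) = true at hf
  rcases of_rec_ble hf with ⟨_, hf⟩ | ⟨h1, hf⟩
  · rw [force_eq] at hf
    change run (2 ^ (m - i)) (masks w m) 0 (birthRun m (m - i) (2 ^ (m - i)) kc K ents) = true at hf
    obtain ⟨r, hf, hr⟩ := run_sound _ _ _ _ hf
    rw [zero_add] at hf
    rcases of_rec_ble hf with ⟨_, hf⟩ | ⟨h2, hf⟩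
    · exact hkc hf
    · rw [force_eq] at hf
      change Bool.rec (motive := fun _ => Bool) (K ents)
        (force (fun pw => K (Cand.cons pw (m + (m - i) - r) ents)) (2 * 2 ^ (m - i)))
        (Nat.ble (m + (m - i) - r) 85) = true at hf
      have key : (m + 1 - i ≤ 43 ∧ First w n i l (m + 1 - i)) →
          EntryOK w n (m + 1) (2 * 2 ^ (m - i)) (m + (m - i) - r) := by
        rintro ⟨hp, L, R, e, hL, hn', hlast, hR, hLe⟩
        have hLr : L ≤ r := by
          apply hr
          intro x hx
          rw [testBit_getD_masks]
          refine ⟨by omega, by omega, by omega, ?_⟩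
          have := hLe x hx
          rw [show m - 1 - x - (m - i) = i - 1 - x by omega, this]
          congr 1; omega
        refine ⟨m - i + 1, by rw [pow_succ, mul_comm], by omega, by omega, by omega, by omega,
          fun t ht ht' => ⟨by omega, ?_⟩⟩
        have := hR (t - (m + 1)) (by omega)
        rw [show t - (m - i + 1) = i + (t - (m + 1)) by omega, this]
        congr 1; omega
      rcases of_rec_ble hf with ⟨h3, hf⟩ | ⟨h3, hf⟩
      · rw [force_eq] at hf
        refine hK _ ?_ hf
        rcases h with h | h | h
        · exact Or.inl (Or.inr h)
        · exact Or.inl (Or.inl (key h))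
        · exact Or.inr h
      · refine hK _ ?_ hf
        rcases h with h | h | h
        · exact Or.inl h
        -- A candidate that is due after position 85 does not fit into a word of length at most 86.
        · obtain ⟨d, _, _, _, _, _, _⟩ := key h
          omega
        · exact Or.inr h
  · refine hK _ ?_ hf
    rcases h with h | h | h
    · exact Or.inl h
    · omega
    · exact Or.inr h

theorem late_step {w : ℕ → ℕ} {n i l m : ℕ} (h : Late w n i l m) :
    (m + 1 - i ≤ 43 ∧ First w n i l (m + 1 - i)) ∨ Late w n i l (m + 1) := by
  obtain ⟨p, hp, h, hm⟩ := h
  by_cases hc : p = m + 1 - i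
  · subst hc; exact Or.inl ⟨hp, h⟩
  · exact Or.inr ⟨p, hp, h, by omega⟩

theorem late_step_of_ne {w : ℕ → ℕ} {n i l m : ℕ} (h : Late w n i l m) (hl : w m ≠ l) :
    Late w n i l (m + 1) := by
  obtain ⟨p, hp, h, hm⟩ := h
  refine ⟨p, hp, h, ?_⟩
  obtain ⟨L, R, e, hL, hn', hlast, hR, hLe⟩ := h
  by_contra hc
  apply hl
  rw [← hlast]; congr 1; omega

theorem birthIf_sound {w : ℕ → ℕ} {n m i l : ℕ} {kc : Bool} {K : Cand → Bool} {G : Prop}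
    (hn : n ≤ 86) (hi : i < m)
    (hkc : kc = true → G)
    (hK : ∀ ents : Cand, ents.OK w n (m + 1) ∨ Late w n i l (m + 1) → K ents = true → G)
    (ents : Cand) (h : ents.OK w n (m + 1) ∨ Late w n i l m)
    (hf : birthIf m (w m) (masks w m) l i kc K ents = true) : G := by
  rcases of_rec_beq hf with ⟨_, hf⟩ | ⟨hl, hf⟩
  · exact birth_sound hn hi hkc hK ents (h.imp id late_step) hf
  · exact hK _ (h.imp id fun h => late_step_of_ne h hl) hf

theorem conv_sound {w : ℕ → ℕ} {n i l : ℕ} {kc : Bool} {K : Cand → Bool} {G X : Prop}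
    (hn : n ≤ 86)
    (hkc : kc = true → G)
    (hK : ∀ ents : Cand, ents.OK w n (i + 2) ∨ X → K ents = true → G) :
    ∀ fuel S (acc : Cand), ((∃ p R, p ≤ 43 ∧ 2 ≤ R ∧ S.testBit p = true ∧ Second w n i l p R) ∨
        acc.OK w n (i + 2) ∨ X) →
      Nat.rec (motive := fun _ => ConvT) (convZero kc) (convSucc i (i + 1) (masks w i) kc K) fuel
        S acc = true → G := by
  intro fuel
  induction fuel with
  | zero => intro S acc _ hf; exact hkc hf
  | succ fuel ih =>
    intro S acc h hf
    cases S with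
    | zero =>
      refine hK acc ?_ hf
      rcases h with ⟨p, R, _, _, h, _⟩ | h
      · simp at h
      · exact h
    | succ s =>
      generalize hih : Nat.rec (motive := fun _ => ConvT) (convZero kc)
        (convSucc i (i + 1) (masks w i) kc K) fuel = rec at ih
      change force (convBit i (i + 1) (masks w i) kc (Nat.rec (motive := fun _ => ConvT)
        (convZero kc) (convSucc i (i + 1) (masks w i) kc K) fuel) (Nat.succ s) acc)
        (Nat.log2 (Nat.succ s)) = true at hf
      rw [hih, force_eq] at hf
      -- Soundness does not depend on which bit is removed first.
      generalize Nat.log2 (Nat.succ s) = q at hf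
      rw [convBit, force_eq] at hf
      change run (2 ^ q) (masks w i) 0 (convRun i (i + 1) kc rec (s + 1) acc q (2 ^ q)) = true at hf
      obtain ⟨r, hf, hr⟩ := run_sound _ _ _ _ hf
      rw [zero_add, convRun, force_eq] at hf
      change Bool.rec (motive := fun _ => Bool)
        (Bool.rec (motive := fun _ => Bool) (rec ((s + 1) ^^^ 2 ^ q) acc)
          (rec ((s + 1) ^^^ 2 ^ q) (Cand.cons (2 ^ q / 2) (i + (q - 2) - r) acc))
          (Nat.ble (i + (q - 2) - r) 85))
        kc (Nat.ble (i + (q - 2) - r) (i + 1)) = true at hf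
      have hx : ∀ p, p ≠ q → (s + 1).testBit p = true → ((s + 1) ^^^ 2 ^ q).testBit p = true := by
        intro p hp h
        rw [Nat.testBit_xor, Nat.testBit_two_pow, h]
        simp [Ne.symm hp]
      rcases of_rec_ble hf with ⟨_, hf⟩ | ⟨h1, hf⟩
      · exact hkc hf
      · have key : (∃ R, q ≤ 43 ∧ 2 ≤ R ∧ Second w n i l q R) →
            EntryOK w n (i + 2) (2 ^ q / 2) (i + (q - 2) - r) := by
          rintro ⟨R, hq, hR2, L, e, hL, hn', hlast, hR, hLe⟩
          have hLr : L ≤ r := by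
            apply hr
            intro x hx
            rw [testBit_getD_masks]
            refine ⟨by omega, by omega, by omega, ?_⟩
            rw [hLe x hx]
            congr 1; omega
          refine ⟨q - 1, ?_, by omega, by omega, by omega, by omega, fun t ht ht' => ⟨by omega, ?_⟩⟩
          · obtain ⟨q', rfl⟩ : ∃ q', q = q' + 1 := ⟨q - 1, by omega⟩
            rw [pow_succ]; simp
          · have := hR (t - i) (by omega)
            rw [show t = i + (t - i) by omega, this]
            congr 1; omega
        have split : (∃ p R, p ≤ 43 ∧ 2 ≤ R ∧ (s + 1).testBit p = true ∧ Second w n i l p R) →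
            (∃ R, q ≤ 43 ∧ 2 ≤ R ∧ Second w n i l q R) ∨
            ∃ p R, p ≤ 43 ∧ 2 ≤ R ∧ ((s + 1) ^^^ 2 ^ q).testBit p = true ∧ Second w n i l p R := by
          rintro ⟨p, R, h2, h3, h4, h5⟩
          by_cases hpq : p = q
          · subst hpq; exact Or.inl ⟨R, h2, h3, h5⟩
          · exact Or.inr ⟨p, R, h2, h3, hx p hpq h4, h5⟩
        rcases of_rec_ble hf with ⟨h2, hf⟩ | ⟨h2, hf⟩
        · refine ih _ _ ?_ hf
          rcases h with h | h | h
          · rcases split h with h | h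
            · exact Or.inr (Or.inl (Or.inl (key h)))
            · exact Or.inl h
          · exact Or.inr (Or.inl (Or.inr h))
          · exact Or.inr (Or.inr h)
        · refine ih _ _ ?_ hf
          rcases h with h | h
          · rcases split h with h | h
            · obtain ⟨d, _, _, _, _, _, _⟩ := key h
              omega
            · exact Or.inl h
          · exact Or.inr h

end Search

namespace Search

/-! #### Pending gaps -/

/-- Bit `b + δ` survives in all masks that are read, so the intersection never becomes zero.
Whenever the bit under test is missing, the walk passes to the next one at the price of one further
mask, and `δ` and the fuel drop together. -/
theorem futureWalk_sound (es : List ℕ) : ∀ U skip b fuel δ, δ ≤ fuel → U.testBit (b + δ) = true →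
    (∀ x < skip + 1 + δ, x < es.length → (es.getD x 0).testBit (b + δ) = true) →
    futureWalk es U skip (2 ^ b) fuel = true := by
  induction es with
  | nil => intros; rfl
  | cons e es ih =>
    intro U skip b fuel δ hδ hU h
    have he : e.testBit (b + δ) = true := by simpa using h 0 (by omega) (by simp)
    have hUe : (Nat.land U e).testBit (b + δ) = true := by
      change (U &&& e).testBit (b + δ) = true
      rw [Nat.testBit_and, hU, he]; rfl
    change Nat.rec (motive := fun _ => Bool) false (futureLive (futureWalk es) skip (2 ^ b) fuel)
      (Nat.land U e) = true
    rcases hu : Nat.land U e with _ | u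
    · rw [hu] at hUe; simp at hUe
    · rw [hu] at hUe
      cases skip with
      | succ s =>
        refine ih (u + 1) s b fuel δ hδ hUe fun x hx hl => ?_
        have := h (x + 1) (by omega) (by simpa using hl)
        rwa [List.getD_cons_succ] at this
      | zero =>
        change Bool.rec (motive := fun _ => Bool) true (Nat.rec (motive := fun _ => Bool) false
          (futureNext (futureWalk es) (u + 1) (2 ^ b)) fuel)
          (Nat.beq (Nat.land (u + 1) (2 ^ b)) 0) = true
        cases hb : Nat.beq (Nat.land (u + 1) (2 ^ b)) 0
        · rfl
        · have hb := Nat.eq_of_beq_eq_true hb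
          rw [land_two_pow_eq_zero] at hb
          have hδ0 : δ ≠ 0 := by
            rintro rfl
            rw [add_zero, hb] at hUe; simp at hUe
          cases fuel with
          | zero => omega
          | succ fuel =>
            change futureWalk es (u + 1) 0 (2 ^ b * 2) fuel = true
            rw [← pow_succ]
            obtain ⟨δ, rfl⟩ : ∃ d, δ = d + 1 := ⟨δ - 1, by omega⟩
            rw [show b + (δ + 1) = b + 1 + δ by omega] at *
            refine ih (u + 1) 0 (b + 1) fuel δ (by omega) hUe fun x hx hl => ?_
            have := h (x + 1) (by omega) (by simpa using hl)
            rwa [List.getD_cons_succ] at this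

theorem future_sound {w : ℕ → ℕ} {n i l m : ℕ} (hn : n ≤ 86) (hi : i ≤ m)
    (hm : i + 85 < 2 * (m + 1)) (h : Late w n i l (m + 1)) :
    future m (masks w (m + 1)) (matchMask w m) i = true := by
  obtain ⟨p, hp, ⟨L, R, e, hL, hn', hlast, hR, hLe⟩, hmp⟩ := h
  have h1 : Nat.ble (Nat.sub (Nat.add m 2) i) 43 = true :=
    Nat.ble_eq_true_of_le (by change m + 2 - i ≤ 43; omega)
  rw [future, h1]
  change force (futureLeft (masks w (m + 1)) (matchMask w m) i m) (2 * (m + 1) - (i + 85)) = true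
  rw [force_eq]
  generalize hc : 2 * (m + 1) - (i + 85) = c
  rw [futureLeft, Nat.ble_eq_true_of_le (by omega)]
  change futureWalk (masks w (m + 1)) (matchMask w m) (c - 1) (2 ^ (m + 1 - i))
    (min ((i - c) / 2) (min (84 - m) (41 - (m - i)))) = true
  have key : ∀ x < c - 1 + 1 + (p - (m + 2 - i)), x < m + 1 →
      ((masks w (m + 1)).getD x 0).testBit (m + 1 - i + (p - (m + 2 - i))) = true := by
    intro x hx hx'
    rw [testBit_getD_masks]
    refine ⟨by omega, by omega, by omega, ?_⟩
    have := hLe (x + (p - (m + 2 - i))) (by omega)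
    rw [show m + 1 - 1 - x - (m + 1 - i + (p - (m + 2 - i))) = i - 1 - (x + (p - (m + 2 - i))) by
      omega, this]
    congr 1; omega
  -- The excess of the period over its least possible value `m + 2 - i`.
  apply futureWalk_sound _ _ _ _ _ (p - (m + 2 - i))
  · simp only [le_min_iff]
    refine ⟨?_, by omega, by omega⟩
    rw [Nat.le_div_iff_mul_le two_pos]; omega
  · have := key 0 (by omega) (by omega)
    rwa [getD_masks _ _ _ (by omega)] at this
  · intro x hx hx'
    rw [length_masks] at hx'
    exact key x hx hx'

/-- The entries of the list belong to gaps that need a period at least as recorded. -/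
def Recs.OK (w : ℕ → ℕ) (n : ℕ) : Recs → Prop
  | .nil => True
  | .cons i key p R => (∃ l p', l < 3 ∧ key = 3 * i + l ∧ First w n i l p' ∧ p ≤ p' ∧ p' ≤ 43) ∧
      R.OK w n

theorem scan_sound {w : ℕ → ℕ} {n i l p p' : ℕ} {K : Recs → Bool} {G : Prop} (hw : Extremal w n)
    (hl : l < 3) (h : First w n i l p') (hp : p ≤ p') (hp' : p' ≤ 43)
    (hK : ∀ R : Recs, R.OK w n → K R = true → G) (R : Recs) :
    ∀ acc : Recs, R.OK w n → acc.OK w n → scan i (3 * i + l) p K R acc = true → G := by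
  induction R with
  | nil => exact fun acc _ hacc hf => hK (Recs.cons _ _ _ acc) ⟨⟨l, p', hl, rfl, h, hp, hp'⟩, hacc⟩ hf
  | cons i' key q R ih =>
    rintro acc ⟨⟨l', q', hl', rfl, h', hq, hq'⟩, hR⟩ hacc hf
    rcases of_rec_beq hf with ⟨_, hf⟩ | ⟨hne, hf⟩
    · exact ih acc hR hacc hf
    · rcases of_rec_ble hf with ⟨hle, _⟩ | ⟨_, hf⟩
      -- As `l` and `l'` are less than 3, different keys mean different letters if the positions
      -- agree.
      · exfalso
        change 44 + max i i' ≤ 2 * min p q at hle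
        rcases le_total i i' with hii | hii
        · exact First.false_of_long hw h h' hii (by omega) hp' hq' (by omega) (by omega)
        · exact First.false_of_long hw h' h hii (by omega) hq' hp' (by omega) (by omega)
      · exact ih (Recs.cons _ _ _ acc) hR ⟨⟨l', q', hl', rfl, h', hq, hq'⟩, hacc⟩ hf

/-- The gaps are as stated. -/
def Gaps.OK (w : ℕ → ℕ) (n m : ℕ) : Gaps → Prop
  | .nil => True
  | .bare l _ i g => (l < 3 ∧ i < m ∧ Late w n i l m) ∧ g.OK w n m
  | .young S esi l _ i g => (l < 3 ∧ m = i + 1 ∧ esi = masks w i ∧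
      ((∃ p R, p ≤ 43 ∧ 2 ≤ R ∧ S.testBit p = true ∧ Second w n i l p R) ∨ Late w n i l m)) ∧
      g.OK w n m
  | .full ents l _ i g => (l < 3 ∧ i < m ∧ (ents.OK w n m ∨ Late w n i l m)) ∧ g.OK w n m

section

variable {w : ℕ → ℕ} {n m i l : ℕ} {ih : GapsT} {G : Prop}

theorem keep_sound (hw : Extremal w n) (hl : l < 3) (hi : i < m)
    (hih : ∀ (acc : Gaps) (R : Recs), acc.OK w n (m + 1) → R.OK w n → ih acc R = true → G)
    (T : ℕ) (acc : Gaps) (R : Recs) (hacc : acc.OK w n (m + 1)) (hR : R.OK w n) (ents : Cand)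
    (h : ents.OK w n (m + 1) ∨ Late w n i l (m + 1))
    (hf : keep m (matchMask w m) (masks w m) l T i acc ih R ents = true) : G := by
  cases ents with
  | cons pw tc ents => exact hih (Gaps.full _ l T i acc) R ⟨⟨hl, by omega, h⟩, hacc⟩ hR hf
  | nil =>
    have h : Late w n i l (m + 1) := h.resolve_left id
    have hok : ∀ T, (Gaps.bare l T i acc).OK w n (m + 1) := fun T => ⟨⟨hl, by omega, h⟩, hacc⟩
    rcases of_rec_ble hf with ⟨_, hf⟩ | ⟨_, hf⟩
    · exact hih _ R (hok _) hR hf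
    · obtain ⟨p, hp, hF, hmp⟩ := h
      refine scan_sound hw hl hF (p := m + 2 - i) (by omega) hp ?_ R Recs.nil hR trivial hf
      intro R hR hf
      rcases of_rec_ble hf with ⟨_, hf⟩ | ⟨hm, hf⟩
      · exact hih _ R (hok _) hR hf
      · have hm : ¬ 2 * (m + 1) ≤ i + 85 := hm
        have : future m (List.cons (matchMask w m) (masks w m)) (matchMask w m) i = true :=
          future_sound hw.le hi.le (by omega) ⟨p, hp, hF, hmp⟩
        rw [this] at hf
        exact hih _ R (hok _) hR hf

theorem updBare_sound (hw : Extremal w n) (hl : l < 3) (hi : i < m)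
    (hih : ∀ (acc : Gaps) (R : Recs), acc.OK w n (m + 1) → R.OK w n → ih acc R = true → G)
    (T : ℕ) (g acc : Gaps) (R : Recs) (hacc : acc.OK w n (m + 1)) (hR : R.OK w n)
    (h : Late w n i l m)
    (hf : updBare m (w m) (matchMask w m) (masks w m) l T i g ih acc R = true) : G := by
  rcases of_rec_beq hf with ⟨_, hf⟩ | ⟨hne, hf⟩
  · exact birth_sound hw.le hi (hih acc R hacc hR)
      (fun ents h hf => keep_sound hw hl hi hih T acc R hacc hR ents h hf) Cand.nil
      (Or.inr (late_step h)) hf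
  · exact keep_sound hw hl hi hih T acc R hacc hR Cand.nil (Or.inr (late_step_of_ne h hne)) hf

theorem upd_sound {K : GapsT} (hw : Extremal w n)
    (hK : ∀ (acc : Gaps) (R : Recs), acc.OK w n (m + 1) → R.OK w n → K acc R = true → G)
    (gs : Gaps) : ∀ (acc : Gaps) (R : Recs), gs.OK w n m → acc.OK w n (m + 1) → R.OK w n →
      upd m (w m) (matchMask w m) (masks w m) K gs acc R = true → G := by
  induction gs with
  | nil => exact fun acc R _ hacc hR hf => hK acc R hacc hR hf
  | bare l T i g ih =>
    rintro acc R ⟨⟨hl, hi, h⟩, hg⟩ hacc hR hf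
    exact updBare_sound hw hl hi (fun acc R hacc hR => ih acc R hg hacc hR) T g acc R hacc hR h hf
  | full ents l T i g ih =>
    rintro acc R ⟨⟨hl, hi, h⟩, hg⟩ hacc hR hf
    have hih := fun acc R hacc hR => ih acc R hg hacc hR
    refine filter_sound (X := Late w n i l m) (hih acc R hacc hR) ?_ ents Cand.nil
      (h.imp id Or.inr) hf
    intro ents h hf
    exact birthIf_sound hw.le hi (hih acc R hacc hR)
      (fun ents h hf => keep_sound hw hl hi hih T acc R hacc hR ents h hf) ents h hf
  | young S esi l T i g ih =>
    rintro acc R ⟨⟨hl, rfl, rfl, h⟩, hg⟩ hacc hR hf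
    have hih := fun acc R hacc hR => ih acc R hg hacc hR
    -- Since `R ≥ 2`, the letter at position `i + 1` agrees with its partner at distance `p - 1`;
    -- doubling the match mask turns this into bit `p`.
    have hbit : (∃ p R, p ≤ 43 ∧ 2 ≤ R ∧ S.testBit p = true ∧ Second w n i l p R) →
        ∃ p R, p ≤ 43 ∧ 2 ≤ R ∧ (Nat.land S (Nat.mul 2 (matchMask w (i + 1)))).testBit p = true ∧
          Second w n i l p R := by
      rintro ⟨p, R, hp, hR, hS, h2⟩
      refine ⟨p, R, hp, hR, ?_, h2⟩
      obtain ⟨L, e, hL, hn', hlast, hR', hLe⟩ := h2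
      change (S &&& 2 * matchMask w (i + 1)).testBit p = true
      obtain ⟨q, rfl⟩ : ∃ q, p = q + 1 := ⟨p - 1, by omega⟩
      rw [Nat.testBit_and, hS, testBit_two_mul, Bool.true_and, testBit_matchMask]
      refine ⟨by omega, by omega, by omega, ?_⟩
      rw [hR' 1 (by omega)]
      congr 1; omega
    change Nat.rec (motive := fun _ => Bool) _ _ (Nat.land S (Nat.mul 2 (matchMask w (i + 1))))
      = true at hf
    rcases hs : Nat.land S (Nat.mul 2 (matchMask w (i + 1))) with _ | s
    · rw [hs] at hf
      refine updBare_sound hw hl (by omega) hih T g acc R hacc hR ?_ hf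
      rcases h with h | h
      · obtain ⟨p, R, _, _, h, _⟩ := hbit h
        rw [hs] at h; simp at h
      · exact h
    · rw [hs] at hf
      refine conv_sound (l := l) (X := Late w n i l (i + 1)) hw.le (hih acc R hacc hR) ?_ 44 (s + 1) Cand.nil
        ?_ hf
      · intro ents h hf
        exact birthIf_sound hw.le (by omega) (hih acc R hacc hR)
          (fun ents h hf => keep_sound hw hl (by omega) hih T acc R hacc hR ents h hf) ents h hf
      · rcases h with h | h
        · rw [← hs]; exact Or.inl (hbit h)
        · exact Or.inr (Or.inr h)

end

/-- Appending `l` creates a square suffix. -/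
def Blocks (w : ℕ → ℕ) (m l : ℕ) : Prop :=
  ∃ p, 1 ≤ p ∧ p ≤ 43 ∧ 2 * p ≤ m + 1 ∧ w (m - p) = l ∧
    ∀ x < p - 1, w (m - 1 - x) = w (m - 1 - x - p)

theorem not_blocks_self {w : ℕ → ℕ} {n m : ℕ} (hw : Extremal w n) (hm : m < n) :
    ¬ Blocks w m (w m) := by
  rintro ⟨p, h1, h2, h3, h4, h5⟩
  obtain ⟨t, ht, h⟩ := hw.squareFree (m + 1 - 2 * p) p (by omega) (by omega)
  apply h
  by_cases htp : t = p - 1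
  · subst htp
    rw [show m + 1 - 2 * p + (p - 1) = m - p by omega, h4]; congr 1; omega
  · have := h5 (p - 2 - t) (by omega)
    rw [show m + 1 - 2 * p + t + p = m - 1 - (p - 2 - t) by omega, this]; congr 1; omega

/-- The gap at position `m` needs letters after `m`. -/
theorem gap_of_not_blocks {w : ℕ → ℕ} {n m l : ℕ} (hw : Extremal w n) (hm : m ≤ n) (hl : l < 3)
    (hb : ¬ Blocks w m l) : (∃ p ≤ 43, First w n m l p) ∨
      ∃ p R, p ≤ 43 ∧ 1 ≤ R ∧ Second w n m l p R := by
  obtain ⟨p, hp, h | ⟨R, h⟩⟩ := hw.gap m hm l hl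
  · exact Or.inl ⟨p, hp, h⟩
  · refine Or.inr ⟨p, R, hp, ?_, h⟩
    by_contra hR
    obtain rfl : R = 0 := by omega
    apply hb
    obtain ⟨L, e, hL, hn', hlast, hR, hLe⟩ := h
    refine ⟨p, by omega, hp, by omega, hlast, fun x hx => ?_⟩
    rw [hLe x (by omega)]; congr 1; omega

theorem newGap_sound {w : ℕ → ℕ} {n m l P : ℕ} {K : Gaps → Bool} {G : Prop} (hw : Extremal w n)
    (hm : m < n) (hl : l < 3) (hlm : w m ≠ l) (hb : ¬ Blocks w m l)
    (hP : ∀ q, 2 ≤ q → q ≤ 43 → q ≤ m → (∀ x < q - 2, ((masks w m).getD x 0).testBit q = true) →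
      P.testBit q = true)
    (hK : ∀ g : Gaps, g.OK w n (m + 1) → K g = true → G)
    (hf : newGap m l (matchMask w m) (mask w l m) P (masks w m) K = true) : G := by
  rw [newGap, force_eq] at hf
  generalize Nat.min (Nat.add (Nat.add m 19) (Nat.div (Nat.succ m) 2))
    (Nat.sub (Nat.div (Nat.add m 85) 2) 1) = T at hf
  have hgap : (∃ p R, p ≤ 43 ∧ 1 ≤ R ∧ Second w n m l p R) ∨ Late w n m l (m + 1) := by
    rcases gap_of_not_blocks hw hm.le hl hb with ⟨p, hp, h⟩ | h
    · refine Or.inr ⟨p, hp, h, ?_⟩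
      obtain ⟨L, R, e, hL, hn', hlast, hR, hLe⟩ := h
      by_contra hc
      apply hlm
      rw [← hlast]; congr 1; omega
    · exact Or.inl h
  have hS : ∀ p R, p ≤ 43 → 1 ≤ R → Second w n m l p R →
      (Nat.land (mask w l m) (Nat.mul 2 (matchMask w m))).testBit p = true := by
    rintro p R hp hR ⟨L, e, hL, hn', hlast, hR', hLe⟩
    change (mask w l m &&& 2 * matchMask w m).testBit p = true
    rw [Nat.testBit_and, (testBit_mask w l m p).2 ⟨by omega, by omega, hp, hlast⟩]
    obtain ⟨q, rfl⟩ : ∃ q, p = q + 1 := ⟨p - 1, by omega⟩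
    have h0 := hR' 0 (by omega)
    have hq : q ≠ 0 := by omega
    rw [testBit_two_mul, Bool.true_and, testBit_matchMask]
    refine ⟨by omega, by omega, by omega, ?_⟩
    rw [add_zero] at h0
    rw [h0]; congr 1; omega
  change Nat.rec (motive := fun _ => Bool) (K (Gaps.bare l T m Gaps.nil))
    (newPos P (masks w m) l T m K) (Nat.land (mask w l m) (Nat.mul 2 (matchMask w m))) = true at hf
  rcases hs : Nat.land (mask w l m) (Nat.mul 2 (matchMask w m)) with _ | s
  · rw [hs] at hf
    refine hK (Gaps.bare l T m .nil) ⟨⟨hl, by omega, ?_⟩, trivial⟩ hf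
    rcases hgap with ⟨p, R, hp, hR, h⟩ | h
    · have := hS p R hp hR h
      rw [hs] at this; simp at this
    · exact h
  · rw [hs] at hf
    rcases of_rec_beq hf with ⟨h0, hf⟩ | ⟨_, hf⟩
    · refine hK (Gaps.young (s + 1) _ l T m .nil) ⟨⟨hl, rfl, rfl, ?_⟩, trivial⟩ hf
      rcases hgap with ⟨p, R, hp, hR, h⟩ | h
      · have hSp := hS p R hp hR h
        rw [hs] at hSp
        refine Or.inl ⟨p, R, hp, ?_, hSp, h⟩
        -- If `R = 1`, then `L = p - 2`: the last `p - 2` letters agree at distance `p`, so `p` is a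
        -- bit of `P`, which the test has excluded.
        by_contra hR2
        obtain rfl : R = 1 := by omega
        obtain ⟨L, e, hL, hn', hlast, hR', hLe⟩ := h
        have hPp := hP p (by omega) hp (by omega) fun x hx => by
          rw [testBit_getD_masks]
          refine ⟨by omega, hp, by omega, ?_⟩
          rw [hLe x (by omega)]; congr 1; omega
        have : (Nat.land (s + 1) P).testBit p = true := by
          change ((s + 1) &&& P).testBit p = true
          rw [Nat.testBit_and, hSp, hPp]; rfl
        rw [show Nat.land (s + 1) P = 0 from h0] at this
        simp at this
      · exact Or.inr h
    -- Dropping a gap needs no justification.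
    · exact hK .nil trivial hf

/-! #### Nodes -/

/-- The node after the prefix of length `m` refutes the word. -/
def Sound (w : ℕ → ℕ) (n m : ℕ) (h : NodeT) : Prop :=
  ∀ (gs : Gaps) (R : Recs), m ≤ n → gs.OK w n m → R.OK w n →
    h (masks w m) (mask w 0 m) (mask w 1 m) (mask w 2 m) gs R = true → False

section

variable {w : ℕ → ℕ} {n m : ℕ} {ih : NodeT} {gs : Gaps} {R : Recs}

theorem append_sound (hw : Extremal w n) (hm : m < n) (hih : Sound w n (m + 1) ih)
    (hgs : gs.OK w n m) (hR : R.OK w n) {c e : ℕ} {K : GapsT} (hc : w m = c)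
    (he : matchMask w m = e)
    (hK : K = ih (masks w (m + 1)) (mask w 0 (m + 1)) (mask w 1 (m + 1)) (mask w 2 (m + 1)))
    (acc : Gaps) (hacc : acc.OK w n (m + 1))
    (hf : upd m c e (masks w m) K gs acc R = true) : False := by
  subst hc he hK
  exact upd_sound hw (fun acc R hacc hR h => hih acc R (by omega) hacc hR h) gs acc R hgs hacc hR hf

theorem newGap_append_sound (hw : Extremal w n) (hm : m < n) (hih : Sound w n (m + 1) ih)
    (hgs : gs.OK w n m) (hR : R.OK w n) {c e l d P : ℕ} {K : GapsT} (hc : w m = c)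
    (he : matchMask w m = e)
    (hK : K = ih (masks w (m + 1)) (mask w 0 (m + 1)) (mask w 1 (m + 1)) (mask w 2 (m + 1)))
    (hl : l < 3) (hcl : c ≠ l) (hd : mask w l m = d) (hb : ¬ Blocks w m l)
    (hP : ∀ q, 2 ≤ q → q ≤ 43 → q ≤ m → (∀ x < q - 2, ((masks w m).getD x 0).testBit q = true) →
      P.testBit q = true)
    (hf : newGap m l e d P (masks w m) (append m c e (masks w m) K gs R) = true) : False := by
  refine newGap_sound hw hm hl (hc ▸ hcl) hb hP
    (fun g hg h => append_sound hw hm hih hgs hR hc he hK g hg h) ?_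
  rw [he, hd]; exact hf

theorem land_eq_zero_iff (a b : ℕ) :
    Nat.land a b = 0 ↔ ∀ q, a.testBit q = true → b.testBit q = true → False := by
  change a &&& b = 0 ↔ _
  constructor
  · intro h q ha hb
    have : (a &&& b).testBit q = true := by rw [Nat.testBit_and, ha, hb]; rfl
    rw [h] at this; simp at this
  · intro h
    apply Nat.eq_of_testBit_eq
    intro q
    rw [Nat.testBit_and, Nat.zero_testBit, Bool.and_eq_false_iff]
    by_contra hc
    push Not at hc
    exact h q (by simpa using hc.1) (by simpa using hc.2)

/-- Each recorded gap needs further letters, and none follow the end of the word. -/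
theorem gaps_eq_nil (hgs : gs.OK w n n) : gs = Gaps.nil := by
  cases gs with
  | nil => rfl
  | bare l T i g =>
    obtain ⟨⟨_, _, p, _, ⟨L, R, e, hL, hn', _⟩, h⟩, _⟩ := hgs
    omega
  | young S esi l T i g =>
    obtain ⟨⟨_, hi, _, ⟨p, R, _, hR, _, L, _, _, h, _⟩ | ⟨p, _, ⟨L, R, e, hL, hn', _⟩, h⟩⟩, _⟩ := hgs
    · omega
    · omega
  | full ents l T i g =>
    obtain ⟨⟨_, _, h | ⟨p, _, ⟨L, R, e, hL, hn', _⟩, h⟩⟩, _⟩ := hgs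
    · exfalso
      induction ents with
      | nil => exact h
      | cons pw tc c ih =>
        rcases h with ⟨_, _, _, _, _, _, _⟩ | h
        · omega
        · exact ih h
    · omega

theorem node_sound (hw : Extremal w n) (hn : isLength n = false) (N f : ℕ)
    (hih : Sound w n (N - f + 1) ih) : Sound w n (N - f) (node N f ih) := by
  intro gs R hm hgs hR hf
  rw [node, force_eq, nodeA, force_eq, nodeB, force_eq] at hf
  change nodeC (N - f) ih _ gs R _ _ _ = true at hf
  generalize N - f = m at *
  obtain ⟨Q, P, hf, hQ, hP⟩ := periods_sound _ _ _ 2 _ _ hf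
  have hU : ∀ q, Nat.testBit 17592186044415 q = true ↔ q < 44 := by
    intro q
    rw [show 17592186044415 = 2 ^ 44 - 1 by norm_num, Nat.testBit_two_pow_sub_one]
    simp
  have h2 : ∀ q, Nat.testBit 2 q = true ↔ q = 1 := by
    intro q
    rw [show 2 = 2 ^ 1 by norm_num, Nat.testBit_two_pow, decide_eq_true_eq, eq_comm]
  have hP' : ∀ q, 2 ≤ q → q ≤ 43 → q ≤ m →
      (∀ x < q - 2, ((masks w m).getD x 0).testBit q = true) → P.testBit q = true := by
    intro q h2 h43 hqm h
    refine hP q (Or.inr ⟨h2, (hU q).2 (by omega), ?_, h⟩)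
    rw [length_masks]; omega
  have hfree : ∀ l, Nat.beq (Nat.land (mask w l m) Q) 0 = true ↔ ¬ Blocks w m l := by
    intro l
    rw [Nat.beq_eq, land_eq_zero_iff]
    constructor
    · rintro h ⟨p, h1, h43, hpm, hl, hx⟩
      refine h p ((testBit_mask w l m p).2 ⟨h1, by omega, h43, hl⟩) ((hQ p).2 ?_)
      by_cases hp : p = 1
      · exact Or.inl ((h2 p).2 hp)
      · refine Or.inr ⟨by omega, (hU p).2 (by omega), fun x hx' => ?_⟩
        rw [testBit_getD_masks]
        exact ⟨h1, h43, by omega, (hx x (by omega)).symm⟩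
    · rintro h p h1 h3
      rw [testBit_mask] at h1
      obtain ⟨h1, hpm, h43, hl⟩ := h1
      rcases (hQ p).1 h3 with h3 | ⟨h3, _, h4⟩
      · rw [h2] at h3
        exact h ⟨p, h1, h43, by omega, hl, by omega⟩
      · simp only [testBit_getD_masks] at h4
        have := h4 (p - 2) le_rfl
        exact h ⟨p, h1, h43, by omega, hl, fun x hx => (h4 x (by omega)).2.2.2.symm⟩
  have ha := hfree 0
  have hb := hfree 1
  have hc := hfree 2
  rw [nodePeriods] at hf
  generalize Nat.beq (Nat.land (mask w 0 m) Q) 0 = ta at *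
  generalize Nat.beq (Nat.land (mask w 1 m) Q) 0 = tb at *
  generalize Nat.beq (Nat.land (mask w 2 m) Q) 0 = tc at *
  rcases eq_or_lt_of_le hm with rfl | hm
  -- At the end of the word a free letter would leave a gap that needs later letters. So all letters
  -- are blocked, the leaf is evaluated, and no gap is pending there.
  · have hbl : ∀ l < 3, Blocks w m l := by
      intro l hl
      by_contra hbl
      rcases gap_of_not_blocks hw le_rfl hl hbl with
        ⟨p, hp, L, R, e, hL, hn', _⟩ | ⟨p, R, _, hR, L, _, _, h, _⟩ <;> omega
    have h0 := hbl 0 (by omega)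
    have h1 := hbl 1 (by omega)
    have h2 := hbl 2 (by omega)
    have ha : ta = false := by rw [← Bool.not_eq_true, ha]; exact not_not.2 h0
    have hb : tb = false := by rw [← Bool.not_eq_true, hb]; exact not_not.2 h1
    have hc : tc = false := by rw [← Bool.not_eq_true, hc]; exact not_not.2 h2
    subst ha hb hc
    change leaf m gs = true at hf
    rw [gaps_eq_nil hgs] at hf
    change isLength m = true at hf
    rw [hn] at hf
    exact Bool.false_ne_true hf
  -- The next letter of `w` is always free. If a second letter is free too, inserting it here
  -- becomes a pending gap.
  · have hself := not_blocks_self hw hm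
    have h3 := hw.lt m
    obtain hwm | hwm | hwm : w m = 0 ∨ w m = 1 ∨ w m = 2 := by omega
    · have he : matchMask w m = mask w 0 m := by rw [matchMask, hwm]
      have hK : next0 ih (masks w m) (mask w 0 m) (mask w 1 m) (mask w 2 m) =
          ih (masks w (m + 1)) (mask w 0 (m + 1)) (mask w 1 (m + 1)) (mask w 2 (m + 1)) := by
        simp [next0, masks, mask, he, hwm]
      rw [hwm] at hself
      obtain rfl := ha.2 hself
      cases tb <;> cases tc
      · exact append_sound hw hm hih hgs hR hwm he hK .nil trivial hf
      · exact newGap_append_sound hw hm hih hgs hR hwm he hK (by norm_num) (by norm_num) rfl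
          (hc.1 rfl) hP' (Bool.and_eq_true_iff.1 hf).1
      · exact newGap_append_sound hw hm hih hgs hR hwm he hK (by norm_num) (by norm_num) rfl
          (hb.1 rfl) hP' (Bool.and_eq_true_iff.1 hf).1
      · exact Bool.false_ne_true hf
    · have he : matchMask w m = mask w 1 m := by rw [matchMask, hwm]
      have hK : next1 ih (masks w m) (mask w 0 m) (mask w 1 m) (mask w 2 m) =
          ih (masks w (m + 1)) (mask w 0 (m + 1)) (mask w 1 (m + 1)) (mask w 2 (m + 1)) := by
        simp [next1, masks, mask, he, hwm]
      rw [hwm] at hself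
      obtain rfl := hb.2 hself
      cases ta <;> cases tc
      · exact append_sound hw hm hih hgs hR hwm he hK .nil trivial hf
      · exact newGap_append_sound hw hm hih hgs hR hwm he hK (by norm_num) (by norm_num) rfl
          (hc.1 rfl) hP' (Bool.and_eq_true_iff.1 hf).1
      · exact newGap_append_sound hw hm hih hgs hR hwm he hK (by norm_num) (by norm_num) rfl
          (ha.1 rfl) hP' (Bool.and_eq_true_iff.1 hf).2
      · exact Bool.false_ne_true hf
    · have he : matchMask w m = mask w 2 m := by rw [matchMask, hwm]
      have hK : next2 ih (masks w m) (mask w 0 m) (mask w 1 m) (mask w 2 m) =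
          ih (masks w (m + 1)) (mask w 0 (m + 1)) (mask w 1 (m + 1)) (mask w 2 (m + 1)) := by
        simp [next2, masks, mask, he, hwm]
      rw [hwm] at hself
      obtain rfl := hc.2 hself
      cases ta <;> cases tb
      · exact append_sound hw hm hih hgs hR hwm he hK .nil trivial hf
      · exact newGap_append_sound hw hm hih hgs hR hwm he hK (by norm_num) (by norm_num) rfl
          (hb.1 rfl) hP' (Bool.and_eq_true_iff.1 hf).2
      · exact newGap_append_sound hw hm hih hgs hR hwm he hK (by norm_num) (by norm_num) rfl
          (ha.1 rfl) hP' (Bool.and_eq_true_iff.1 hf).2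
      · exact Bool.false_ne_true hf

theorem search_sound (hw : Extremal w n) (hn : isLength n = false) {N : ℕ} {base : NodeT}
    (hbase : Sound w n (N + 1) base) (fuel : ℕ) (hfuel : fuel ≤ N + 1) :
    Sound w n (N + 1 - fuel) (search N base fuel) := by
  induction fuel with
  | zero => exact hbase
  | succ f ih =>
    have := node_sound (ih := search N base f) hw hn N f
      (by rw [show N - f + 1 = N + 1 - f by omega]; exact ih (by omega))
    rwa [show N + 1 - (f + 1) = N - f by omega]

/-- In front of the word, an inserted letter has no earlier partner, so it lies in the first half of
the square. -/
theorem first_of_second_zero {l : ℕ} (h : ∃ p ≤ 43, First w n 0 l p ∨ ∃ R, Second w n 0 l p R)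
    (hl : w 0 ≠ l) : Late w n 0 l 1 := by
  obtain ⟨p, hp, h | ⟨R, L, e, hL, _⟩⟩ := h
  · refine ⟨p, hp, h, ?_⟩
    obtain ⟨L, R, e, hL, hn', hlast, _⟩ := h
    by_contra hc
    apply hl; rw [← hlast]; congr 1; omega
  · omega

/-- The residue of `mask w 0 19` selects the part of the search that treats `w`; the other parts say
nothing about it. -/
theorem fullSearch_sound (hw : Extremal w n) (hn : isLength n = false) (h2 : 2 ≤ n) (h0 : w 0 = 0)
    (h1 : w 1 = 1) {k : ℕ} (h : fullSearch k (mask w 0 19 % k) = true) : False := by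
  have hdeep : Sound w n 19 (deepSearch k (mask w 0 19 % k)) := by
    intro gs R hm hgs hR hf
    have hf : search 86 endNode 68 (masks w 19) (mask w 0 19) (mask w 1 19) (mask w 2 19) gs R
        = true := by
      rcases of_rec_beq hf with ⟨_, hf⟩ | ⟨h, _⟩
      · exact hf
      · exact absurd rfl h
    exact search_sound hw hn (N := 86) (fun gs R h87 => by have := hw.le; omega) 68 (by omega)
      gs R hm hgs hR hf
  have hih : Sound w n 2 (search 18 (deepSearch k (mask w 0 19 % k)) 17) :=
    search_sound hw hn (N := 18) hdeep 17 (by omega)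
  change child12 1 (search 18 (deepSearch k (mask w 0 19 % k)) 17) [0] 2 0 0
    (Gaps.bare 1 19 0 (Gaps.bare 2 19 0 Gaps.nil)) Recs.nil 0 = true at h
  generalize search 18 (deepSearch k (mask w 0 19 % k)) 17 = ih at *
  have hm0 : mask w 0 1 = 2 := by simp only [mask, h0]; rfl
  have hm1 : mask w 1 1 = 0 := by simp only [mask, h0]; rfl
  have hm2 : mask w 2 1 = 0 := by simp only [mask, h0]; rfl
  have hm : matchMask w 1 = 0 := by rw [matchMask, h1, hm1]
  have hms : masks w 1 = [0] := rfl
  refine newGap_append_sound (m := 1) (R := Recs.nil) (l := 2) (P := 0)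
    (gs := Gaps.bare 1 19 0 (Gaps.bare 2 19 0 Gaps.nil)) hw
    (by omega) hih ?_ trivial h1 hm (K := next1 ih [0] 2 0 0)
    ?_ (by norm_num) (by norm_num) hm2 ?_ ?_ h
  · exact ⟨⟨by norm_num, by norm_num, first_of_second_zero (hw.gap 0 (by omega) 1 (by norm_num))
      (by omega)⟩, ⟨by norm_num, by norm_num,
      first_of_second_zero (hw.gap 0 (by omega) 2 (by norm_num)) (by omega)⟩, trivial⟩
  · have hm0' : mask w 0 2 = shift 2 := by rw [mask, hm0, h1]; rfl
    have hm1' : mask w 1 2 = shiftSucc 0 := by rw [mask, hm1, h1]; rfl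
    have hm2' : mask w 2 2 = shift 0 := by rw [mask, hm2, h1]; rfl
    have hms' : masks w 2 = [0, 0] := by rw [masks, hm, hms]
    rw [hm0', hm1', hm2', hms']; rfl
  · rintro ⟨p, hp, _, hp2, hp', _⟩
    obtain rfl : p = 1 := by omega
    simp [h0] at hp'
  · intro q hq _ hq' _
    omega

end

end Search

/-! ### Square-free words -/

section Words

variable {α β : Type*}

theorem squareFreeWord_iff (u : List α) : SquareFreeWord u ↔
    ∀ s p, 0 < p → s + 2 * p ≤ u.length → ∃ t < p, u[s + t]? ≠ u[s + t + p]? := by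
  constructor
  · intro h s p hp hs
    by_contra hc
    push Not at hc
    apply h ((u.drop s).take p)
    · rw [← List.length_pos_iff]
      simp; omega
    · have : (u.drop s).take p ++ (u.drop s).take p = (u.drop s).take (2 * p) := by
        rw [two_mul, List.take_add, List.drop_drop]
        congr 1
        apply List.ext_getElem?
        intro t
        rw [List.getElem?_take, List.getElem?_take]
        split
        · next ht => rw [List.getElem?_drop, List.getElem?_drop, hc t ht]; congr 1; omega
        · rfl
      rw [this]
      exact (List.take_prefix _ _).isInfix.trans (List.drop_suffix _ _).isInfix
  · rintro h x hx ⟨a, b, rfl⟩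
    obtain ⟨t, ht, h⟩ := h a.length x.length (List.length_pos_iff.2 hx) (by simp; omega)
    apply h
    have h1 : (a ++ (x ++ x) ++ b)[a.length + t]? = x[t]? := by
      rw [List.append_assoc, List.append_assoc, List.getElem?_append_right (by omega),
        Nat.add_sub_cancel_left, List.getElem?_append_left ht]
    have h2 : (a ++ (x ++ x) ++ b)[a.length + t + x.length]? = x[t]? := by
      rw [List.append_assoc, List.append_assoc, List.getElem?_append_right (by omega),
        add_assoc, Nat.add_sub_cancel_left, List.getElem?_append_right (by omega),
        Nat.add_sub_cancel, List.getElem?_append_left ht]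
    rw [h1, h2]

theorem SquareFreeWord.of_infix {u v : List α} (h : SquareFreeWord v) (huv : u <:+: v) :
    SquareFreeWord u :=
  fun x hx hu => h x hx (hu.trans huv)

theorem squareFreeWord_map {f : α → β} (hf : Function.Injective f) (u : List α) :
    SquareFreeWord (u.map f) ↔ SquareFreeWord u := by
  simp only [squareFreeWord_iff, List.length_map, List.getElem?_map, ne_eq,
    (Option.map_injective hf).eq_iff]

theorem squareFreeWord_reverse (u : List α) : SquareFreeWord u.reverse ↔ SquareFreeWord u := by
  have key : ∀ v : List α, SquareFreeWord v → SquareFreeWord v.reverse := by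
    intro v h x hx hxv
    apply h x.reverse (by simpa using hx)
    rw [← List.reverse_append]
    exact List.reverse_infix.1 (by simpa using hxv)
  exact ⟨fun h => by simpa using key _ h, key u⟩

theorem extremalSquareFree_map (e : α ≃ β) (u : List α) :
    ExtremalSquareFree (u.map e) ↔ ExtremalSquareFree u := by
  have key : ∀ {α β : Type _} (e : α ≃ β) (u : List α), ExtremalSquareFree (u.map e) →
      ExtremalSquareFree u := by
    rintro α β e u ⟨h1, h2⟩
    refine ⟨(squareFreeWord_map e.injective u).1 h1, ?_⟩
    rintro v ⟨w₁, w₂, l, rfl, rfl⟩ hv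
    apply h2 _ ⟨w₁.map e, w₂.map e, e l, by simp, rfl⟩
    have := (squareFreeWord_map e.injective _).2 hv
    simpa using this
  refine ⟨key e u, fun h => ?_⟩
  obtain ⟨h1, h2⟩ := h
  refine ⟨(squareFreeWord_map e.injective u).2 h1, ?_⟩
  rintro v ⟨w₁, w₂, l, hw, rfl⟩ hv
  apply h2 ((w₁ ++ [l] ++ w₂).map e.symm) ⟨w₁.map e.symm, w₂.map e.symm, e.symm l, ?_, by simp⟩
  · exact (squareFreeWord_map e.symm.injective _).2 hv
  · have := congrArg (List.map e.symm) hw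
    simpa using this

end Words

/-! ### From extremal square-free words to the words of the search -/

namespace Search

/-- Let the insertion of `l` at position `i` create a square of period `p` at `s`. -/
theorem first_or_second {w : ℕ → ℕ} {n i l s p : ℕ} (hi : i ≤ n) (hp : 0 < p)
    (hs : s + 2 * p ≤ n + 1)
    (hsq : ∀ s p, 0 < p → s + 2 * p ≤ n → ∃ t < p, w (s + t) ≠ w (s + t + p))
    (h : ∀ v : ℕ → ℕ, (∀ k < i, v k = w k) → v i = l → (∀ k, i ≤ k → v (k + 1) = w k) →
      ∀ t < p, v (s + t) = v (s + t + p)) :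
    First w n i l p ∨ ∃ R, Second w n i l p R := by
  -- The extended word. A square in it that misses position `i` would be a square of `w`, so
  -- position `i` lies in one of the halves.
  obtain ⟨v, hv⟩ : ∃ v : ℕ → ℕ, v = fun k => if k < i then w k else if k = i then l else w (k - 1) :=
    ⟨_, rfl⟩
  have h1 : ∀ k < i, v k = w k := fun k hk => by simp [hv, hk]
  have h2 : v i = l := by simp [hv]
  have h3 : ∀ k, i < k → v k = w (k - 1) := fun k hk => by
    have a1 : ¬ k < i := by omega
    have a2 : k ≠ i := by omega
    simp [hv, a1, a2]
  have h := h v h1 h2 fun k hk => h3 (k + 1) (by omega)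
  by_cases hle : s + 2 * p ≤ i
  · obtain ⟨t, ht, hne⟩ := hsq s p hp (by omega)
    refine absurd ?_ hne
    rw [← h1 _ (by omega), ← h1 _ (by omega)]
    exact h t ht
  by_cases hlt : i < s
  · obtain ⟨t, ht, hne⟩ := hsq (s - 1) p hp (by omega)
    refine absurd ?_ hne
    have := h t ht
    rw [h3 _ (by omega), h3 _ (by omega)] at this
    rw [show s - 1 + t = s + t - 1 by omega, this]; congr 1; omega
  by_cases hmid : i < s + p
  · refine Or.inl ⟨i - s, p - 1 - (i - s), by omega, by omega, by omega, ?_, fun r hr => ?_,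
      fun x hx => ?_⟩
    · have := h (i - s) (by omega)
      rw [show s + (i - s) = i by omega, h2, h3 _ (by omega)] at this
      exact this.symm
    · have := h (i - s + 1 + r) (by omega)
      rw [h3 _ (by omega), h3 _ (by omega)] at this
      rw [show i + r = s + (i - s + 1 + r) - 1 by omega, this]; congr 1; omega
    · have := h (i - s - 1 - x) (by omega)
      rw [h1 _ (by omega), h3 _ (by omega)] at this
      rw [show i - 1 - x = s + (i - s - 1 - x) by omega, this]; congr 1; omega
  · refine Or.inr ⟨p - 1 - (i - s - p), i - s - p, by omega, by omega, by omega, ?_, fun r hr => ?_,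
      fun x hx => ?_⟩
    · have := h (i - s - p) (by omega)
      rw [show s + (i - s - p) + p = i by omega, h2, h1 _ (by omega)] at this
      rw [← this]; congr 1; omega
    · have := h (i - s - p + 1 + r) (by omega)
      rw [h3 (s + _ + p) (by omega), h1 _ (by omega)] at this
      rw [show i + r = s + (i - s - p + 1 + r) + p - 1 by omega, ← this]; congr 1; omega
    · have := h (i - s - p - 1 - x) (by omega)
      rw [h1 _ (by omega), h1 _ (by omega)] at this
      rw [show i - 1 - x = s + (i - s - p - 1 - x) + p by omega, ← this]; congr 1; omega

/-- The default value 0 past the end keeps all values below 3; the other conditions concern only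
positions inside the word. -/
theorem extremal_of_extremalSquareFree {u : List (Fin 3)} (hu : ExtremalSquareFree u)
    (hn : u.length ≤ 86) :
    Extremal (fun k => ((u[k]?.getD 0 : Fin 3) : ℕ)) u.length := by
  have hw : ∀ s p, 0 < p → s + 2 * p ≤ u.length →
      ∃ t < p, ((u[s + t]?.getD 0 : Fin 3) : ℕ) ≠ ((u[s + t + p]?.getD 0 : Fin 3) : ℕ) := by
    intro s p hp hs
    obtain ⟨t, ht, h⟩ := (squareFreeWord_iff u).1 hu.1 s p hp hs
    refine ⟨t, ht, fun he => h ?_⟩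
    rw [List.getElem?_eq_getElem (by omega), List.getElem?_eq_getElem (by omega)] at he ⊢
    rw [Option.getD_some, Option.getD_some] at he
    rw [Fin.ext he]
  refine ⟨fun t => Fin.isLt _, hn, hw, ?_⟩
  intro i hi l hl
  have hv := hu.2 (u.take i ++ [(⟨l, hl⟩ : Fin 3)] ++ u.drop i) ⟨u.take i, u.drop i, ⟨l, hl⟩, by simp, rfl⟩
  rw [squareFreeWord_iff] at hv
  push Not at hv
  obtain ⟨s, p, hp, hs, h⟩ := hv
  have hlen : (u.take i ++ [(⟨l, hl⟩ : Fin 3)] ++ u.drop i).length = u.length + 1 := by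
    simp; omega
  rw [hlen] at hs
  -- The extension has at most 87 letters, hence `p ≤ 43`.
  refine ⟨p, by omega, first_or_second hi hp hs hw ?_⟩
  intro v h1 h2 h3 t ht
  have key : ∀ k < u.length + 1,
      v k = (((u.take i ++ [(⟨l, hl⟩ : Fin 3)] ++ u.drop i)[k]?.getD 0 : Fin 3) : ℕ) := by
    intro k hk
    rcases lt_trichotomy k i with hki | rfl | hki
    · rw [h1 k hki, List.append_assoc, List.getElem?_append_left (by simp; omega),
        List.getElem?_take_of_lt hki]
    · rw [h2, List.append_assoc, List.getElem?_append_right (by simp)]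
      simp [Nat.min_eq_left hi]
    · obtain ⟨k, rfl⟩ : ∃ j, k = j + 1 := ⟨k - 1, by omega⟩
      rw [h3 k (by omega), List.getElem?_append_right (by simp; omega), List.getElem?_drop]
      congr 3
      simp; omega
  rw [key _ (by omega), key _ (by omega), h t ht]

end Search

/-- The alphabet, numbered. -/
def letterEquiv : Letter ≃ Fin 3 where
  toFun | .a => 0 | .b => 1 | .c => 2
  invFun | 0 => .a | 1 => .b | 2 => .c
  left_inv x := by cases x <;> rfl
  right_inv x := by fin_cases x <;> rfl

theorem SquareFreeWord.singleton {α : Type*} (x : α) : SquareFreeWord [x] := by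
  rw [squareFreeWord_iff]
  intro s p hp hs
  simp at hs; omega

theorem SquareFreeWord.pair {α : Type*} {x y : α} (h : x ≠ y) : SquareFreeWord [x, y] := by
  rw [squareFreeWord_iff]
  intro s p hp hs
  simp only [List.length_cons, List.length_nil] at hs
  obtain rfl : p = 1 := by omega
  obtain rfl : s = 0 := by omega
  exact ⟨0, one_pos, by simpa using h⟩

open Search in
/-- The search finds all lengths up to 86 of extremal square-free words. -/
theorem isLength_of_fullSearch (h : ∀ r < 11, fullSearch 11 r = true)
    {u : List Letter} (hu : ExtremalSquareFree u) (hn : u.length ≤ 86) :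
    isLength u.length = true := by
  by_contra hl
  rw [Bool.not_eq_true] at hl
  match u with
  | [] => exact hu.2 [.a] ⟨[], [], .a, rfl, rfl⟩ (.singleton _)
  | [x] =>
    obtain ⟨y, hxy⟩ : ∃ y, x ≠ y := by
      cases x
      · exact ⟨.b, nofun⟩
      · exact ⟨.a, nofun⟩
      · exact ⟨.a, nofun⟩
    exact hu.2 [x, y] ⟨[x], [], y, rfl, rfl⟩ (.pair hxy)
  | x :: y :: v =>
    have hxy : x ≠ y := by
      rintro rfl
      exact hu.1 [x] (by simp) ⟨[], v, rfl⟩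
    obtain ⟨σ, h0, h1⟩ : ∃ σ : Equiv.Perm (Fin 3), σ (letterEquiv x) = 0 ∧ σ (letterEquiv y) = 1 := by
      have key : ∀ a b : Fin 3, a ≠ b → ∃ σ : Equiv.Perm (Fin 3), σ a = 0 ∧ σ b = 1 := by decide
      exact key _ _ (letterEquiv.injective.ne hxy)
    have hv := (extremalSquareFree_map (letterEquiv.trans σ) _).2 hu
    have hlen : ((x :: y :: v).map (letterEquiv.trans σ)).length = (x :: y :: v).length :=
      List.length_map _
    have hw := extremal_of_extremalSquareFree hv (by rw [hlen]; exact hn)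
    rw [hlen] at hw
    exact fullSearch_sound hw hl (by simp) (by simp [h0]) (by simp [h1])
      (h _ (Nat.mod_lt _ (by norm_num)))

/-! ### Evaluation of the search, in eleven residue classes -/

namespace Search
theorem fullSearch_0 : fullSearch 11 0 = true := by decide +kernel
theorem fullSearch_1 : fullSearch 11 1 = true := by decide +kernel
theorem fullSearch_2 : fullSearch 11 2 = true := by decide +kernel
theorem fullSearch_3 : fullSearch 11 3 = true := by decide +kernel
theorem fullSearch_4 : fullSearch 11 4 = true := by decide +kernel
theorem fullSearch_5 : fullSearch 11 5 = true := by decide +kernel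
theorem fullSearch_6 : fullSearch 11 6 = true := by decide +kernel
theorem fullSearch_7 : fullSearch 11 7 = true := by decide +kernel
theorem fullSearch_8 : fullSearch 11 8 = true := by decide +kernel
theorem fullSearch_9 : fullSearch 11 9 = true := by decide +kernel
theorem fullSearch_10 : fullSearch 11 10 = true := by decide +kernel
end Search

/-! ### Verification of explicit words -/

namespace Check

noncomputable section

open Search (force)

/-! Is there no square? -/

def bitsCons (c x : ℕ) (_ : List ℕ) (ih : ℕ) : ℕ :=
  Bool.rec (motive := fun _ => ℕ) (Nat.mul 2 ih) (Nat.succ (Nat.mul 2 ih)) (Nat.beq x c)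
/-- Mask of the positions of a letter. -/
def bits (c : ℕ) (u : List ℕ) : ℕ := List.rec (motive := fun _ => ℕ) 0 (bitsCons c) u

/-- Intersecting a mask with its shift shortens each run of bits by one. -/
def runFreeSucc (_ : ℕ) (ih : ℕ → Bool) (y : ℕ) : Bool :=
  Nat.rec (motive := fun _ => Bool) true (fun z _ => force ih (Nat.land (Nat.succ z)
    (Nat.div (Nat.succ z) 2))) y
def runFreeZero (y : ℕ) : Bool := Nat.beq y 0
/-- Does the mask have no run of more than `r` bits? -/
def runFree (r : ℕ) : ℕ → Bool := Nat.rec (motive := fun _ => ℕ → Bool) runFreeZero runFreeSucc r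

abbrev PeriodT := ℕ → ℕ → ℕ → ℕ → Bool
def periodFreeNext (ih : PeriodT) (A B M q : ℕ) : Bool :=
  force (fun A => force (fun B => force (fun M => force (ih A B M) (Nat.succ q)) (Nat.div M 2))
    (Nat.div B 2)) (Nat.div A 2)
-- The mask that is tested consists of the positions whose letter recurs `q + 1` places later; the
-- masks of two letters determine the third. A square of period `q + 1` is a run of `q + 1` such
-- positions.
def periodFreeSucc (A₀ B₀ _ : ℕ) (ih : PeriodT) (A B M q : ℕ) : Bool :=
  Bool.rec (motive := fun _ => Bool) false (periodFreeNext ih A B M q)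
    (force (runFree q) (Nat.xor M (Nat.land M (Nat.lor (Nat.xor A₀ A) (Nat.xor B₀ B)))))
def periodFreeZero (_ _ _ _ : ℕ) : Bool := true
/-- Is there no square with a period from `q + 1` on? `A` and `B` are the masks of two letters,
shifted by `q + 1`, and `M` is a mask for the length that is left. -/
def periodFree (A₀ B₀ fuel : ℕ) : PeriodT :=
  Nat.rec (motive := fun _ => PeriodT) periodFreeZero (periodFreeSucc A₀ B₀) fuel
def squareFreeMasks (n A B : ℕ) : Bool :=
  periodFree A B (Nat.div n 2) (Nat.div A 2) (Nat.div B 2)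
    (Nat.pred (Nat.pow 2 (Nat.pred n))) 0
def squareFree (u : List ℕ) : Bool :=
  force (fun A => force (squareFreeMasks (List.length u) A) (bits 2 u)) (bits 1 u)

/-! Does the insertion of a letter create a square? -/

abbrev WalkT := List ℕ → ℕ → (ℕ → Bool) → Bool
def walkHead (ih : WalkT) (r : ℕ) (k : ℕ → Bool) (x y : ℕ) (c : List ℕ) (_ : Bool) : Bool :=
  Bool.rec (motive := fun _ => Bool) (k (Nat.succ r)) (ih c r k) (Nat.beq x y)
def walkPos (ih : WalkT) (k : ℕ → Bool) (x : ℕ) (c : List ℕ) (r : ℕ) (_ : Bool) : Bool :=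
  List.rec (motive := fun _ => Bool) (k (Nat.succ r)) (walkHead ih r k x) c
def walkCons (x : ℕ) (_ : List ℕ) (ih : WalkT) (c : List ℕ) (r : ℕ) (k : ℕ → Bool) : Bool :=
  Nat.rec (motive := fun _ => Bool) true (walkPos ih k x c) r
def walkNil (_ : List ℕ) (r : ℕ) (k : ℕ → Bool) : Bool := k r
/-- Do the two words agree in `r` places? Otherwise, go on with the number of missing agreements. -/
def walk (a : List ℕ) : WalkT := List.rec (motive := fun _ => WalkT) walkNil walkCons a

abbrev ScanT := List ℕ → ℕ → ℕ → Bool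
def scanStep (ih : ScanT) (c : List ℕ) (n f : ℕ) (_ : Bool) : Bool := ih c (Nat.succ n) f
def scanNext (ih : ScanT) (x : ℕ) (c : List ℕ) (n f : ℕ) : Bool :=
  Nat.rec (motive := fun _ => Bool) false (scanStep ih (List.cons x c) n) f
def scanFail (ih : ScanT) (x : ℕ) (c : List ℕ) (n f : ℕ) (_ : ℕ) (_ : Bool) : Bool :=
  scanNext ih x c n f
def scanEnd (ih : ScanT) (x : ℕ) (c : List ℕ) (n f : ℕ) (r : ℕ) : Bool :=
  Nat.rec (motive := fun _ => Bool) true (scanFail ih x c n f) r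
def scanRight (b d : List ℕ) (ih : ScanT) (x : ℕ) (c : List ℕ) (n f : ℕ) (r : ℕ) : Bool :=
  walk b d r (scanEnd ih x c n f)
def scanCons (l : ℕ) (a b : List ℕ) (x : ℕ) (d : List ℕ) (ih : ScanT) (c : List ℕ) (n f : ℕ) :
    Bool :=
  Bool.rec (motive := fun _ => Bool) (scanNext ih x c n f)
    (walk a c n (scanRight b d ih x c n f)) (Nat.beq x l)
def scanNil (_ : List ℕ) (_ _ : ℕ) : Bool := false
/-- Does the insertion of `l` between `a.reverse` and `b` create a square with the inserted letter in
its first half? The other arguments are the part of `b` that has not been read, the one that has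
been, reversed, the length of the latter, and a bound on the number of further letters. -/
def scan (l : ℕ) (a b d : List ℕ) : ScanT :=
  List.rec (motive := fun _ => ScanT) scanNil (scanCons l a b) d

/-- Exchanging `a` and `b` reverses the word, which accounts for squares with the inserted letter in
the second half. -/
def blockedBy (l f : ℕ) (a b : List ℕ) (other : Bool) : Bool :=
  Bool.rec (motive := fun _ => Bool)
    (Bool.rec (motive := fun _ => Bool) other true (scan l b a a List.nil 0 f)) true
    (scan l a b b List.nil 0 f)
-- The increasing bounds try short periods on both sides first; they do not matter for soundness.
def blockedLetter (l : ℕ) (a b : List ℕ) (other : Bool) : Bool :=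
  Bool.rec (motive := fun _ => Bool) false other
    (blockedBy l 0 a b (blockedBy l 14 a b (blockedBy l 1000 a b false)))
/-- Does the insertion of any letter between `a.reverse` and `b` create a square? -/
def blocked (a b : List ℕ) : Bool :=
  blockedLetter 0 a b (blockedLetter 1 a b (blockedLetter 2 a b true))

abbrev GapsT := List ℕ → ℕ → Bool
def gapsStep (ih : GapsT) (a : List ℕ) (n : ℕ) (_ : Bool) : Bool := ih a n
def gapsCons (x : ℕ) (b : List ℕ) (ih : GapsT) (a : List ℕ) (n : ℕ) : Bool :=
  Bool.rec (motive := fun _ => Bool) false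
    (Nat.rec (motive := fun _ => Bool) true (gapsStep ih (List.cons x a)) n)
    (blocked a (List.cons x b))
def gapsNil (a : List ℕ) (_ : ℕ) : Bool := blocked a List.nil
/-- Are the first gaps of `b` blocked, when `b` is preceded by `a.reverse`? -/
def gaps (b : List ℕ) : GapsT := List.rec (motive := fun _ => GapsT) gapsNil gapsCons b

/-! Words, encoded in base 3. -/

def readPush (K : List ℕ → Bool) (x : ℕ) (u : List ℕ) : Bool := K (List.cons x u)
def readDiv (ih : ℕ → (List ℕ → Bool) → Bool) (K : List ℕ → Bool) (x c : ℕ) : Bool :=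
  ih c (readPush K x)
def readRest (ih : ℕ → (List ℕ → Bool) → Bool) (c : ℕ) (K : List ℕ → Bool) (x : ℕ) : Bool :=
  force (readDiv ih K x) (Nat.div c 3)
def readLetter (_ : ℕ) (ih : ℕ → (List ℕ → Bool) → Bool) (c : ℕ) (K : List ℕ → Bool) : Bool :=
  force (readRest ih c K) (Nat.mod c 3)
def readEnd (_ : ℕ) (K : List ℕ → Bool) : Bool := K List.nil
def read (n : ℕ) : ℕ → (List ℕ → Bool) → Bool :=
  Nat.rec (motive := fun _ => ℕ → (List ℕ → Bool) → Bool) readEnd readLetter n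

def extremalWord (u : List ℕ) : Bool :=
  Bool.rec (motive := fun _ => Bool) false (gaps u List.nil 1000) (squareFree u)
def extremal (n c : ℕ) : Bool := read n c extremalWord

end

end Check

/-! ### Soundness of the verification -/

namespace Check

open Search (force force_eq)

theorem testBit_bits (c : ℕ) (u : List ℕ) (i : ℕ) :
    (bits c u).testBit i = decide (u[i]? = some c) := by
  induction u generalizing i with
  | nil => simp [bits]
  | cons x u ih =>
    have e : bits c (x :: u) = 2 * bits c u + if x = c then 1 else 0 := by
      change Bool.rec (motive := fun _ => ℕ) (2 * bits c u) (2 * bits c u + 1) (Nat.beq x c) = _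
      by_cases h : x = c
      · subst h; simp
      · have : Nat.beq x c = false := by rw [← Bool.not_eq_true, Nat.beq_eq]; exact h
        simp [this, h]
    rw [e]
    cases i with
    | zero => by_cases h : x = c <;> simp [h]
    | succ i =>
      rw [Nat.testBit_succ]
      have : (2 * bits c u + if x = c then 1 else 0) / 2 = bits c u := by split <;> omega
      rw [this, ih]
      simp

theorem runFree_sound (r : ℕ) : ∀ y, runFree r y = true → ∀ s, ¬ ∀ t ≤ r, y.testBit (s + t) = true := by
  induction r with
  | zero =>
    intro y h s hs
    obtain rfl := Nat.eq_of_beq_eq_true h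
    simpa using hs 0 le_rfl
  | succ r ih =>
    intro y h s hs
    cases y with
    | zero => simpa using hs 0 (Nat.zero_le _)
    | succ z =>
      change force (runFree r) ((z + 1) &&& ((z + 1) / 2)) = true at h
      rw [force_eq] at h
      refine ih _ h s fun t ht => ?_
      have h1 := hs (t + 1) (by omega)
      rw [← add_assoc, Nat.testBit_succ] at h1
      rw [Nat.testBit_and, hs t (by omega), h1]; rfl

theorem periodFree_sound (u : List ℕ) (A B : ℕ) (hA : A = bits 1 u) (hB : B = bits 2 u) (fuel : ℕ) :
    ∀ q A' B' M, (∀ i, A'.testBit i = A.testBit (i + (q + 1))) →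
      (∀ i, B'.testBit i = B.testBit (i + (q + 1))) →
      (∀ i, M.testBit i = decide (i + (q + 1) < u.length)) →
      periodFree A B fuel A' B' M q = true →
      ∀ p, q < p → p ≤ q + fuel → ∀ s, s + 2 * p ≤ u.length →
        ¬ ∀ t < p, u[s + t]? = u[s + t + p]? := by
  induction fuel with
  | zero => intros; omega
  | succ fuel ih =>
    intro q A' B' M hA' hB' hM h p hp hpf s hs hsq
    have h' : Bool.rec (motive := fun _ => Bool) false
        (periodFreeNext (periodFree A B fuel) A' B' M q)
        (force (runFree q) (M ^^^ (M &&& ((A ^^^ A') ||| (B ^^^ B'))))) = true := h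
    rw [force_eq] at h'
    rcases hr : runFree q (M ^^^ (M &&& ((A ^^^ A') ||| (B ^^^ B'))))
    · rw [hr] at h'; exact Bool.false_ne_true h'
    · rw [hr] at h'
      by_cases hpq : p = q + 1
      · subst hpq
        refine runFree_sound q _ hr s fun t ht => ?_
        have := hsq t (by omega)
        simp only [Nat.testBit_xor, Nat.testBit_and, Nat.testBit_or, hM, hA', hB', hA, hB,
          testBit_bits, this]
        have hlt : s + t + (q + 1) < u.length := by omega
        simp [hlt]
      · change periodFreeNext (periodFree A B fuel) A' B' M q = true at h'
        simp only [periodFreeNext, force_eq] at h'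
        refine ih (q + 1) _ _ _ ?_ ?_ ?_ h' p (by omega) (by omega) s hs hsq
        · intro i
          change (A' / 2).testBit i = _
          rw [← Nat.testBit_succ, hA']; congr 1; omega
        · intro i
          change (B' / 2).testBit i = _
          rw [← Nat.testBit_succ, hB']; congr 1; omega
        · intro i
          change (M / 2).testBit i = _
          rw [← Nat.testBit_succ, hM, decide_eq_decide]; omega

theorem squareFree_sound {u : List ℕ} (h : squareFree u = true) : SquareFreeWord u := by
  rw [squareFree, force_eq, force_eq] at h
  rw [squareFreeWord_iff]
  intro s p hp hs
  by_contra hc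
  push Not at hc
  refine periodFree_sound u _ _ rfl rfl _ 0 _ _ _ ?_ ?_ ?_ h p hp ?_ s hs hc
  · intro i
    change (bits 1 u / 2).testBit i = _
    rw [← Nat.testBit_succ]
  · intro i
    change (bits 2 u / 2).testBit i = _
    rw [← Nat.testBit_succ]
  · intro i
    change (2 ^ (u.length - 1) - 1).testBit i = _
    rw [Nat.testBit_two_pow_sub_one, decide_eq_decide]; omega
  · change p ≤ 0 + u.length / 2
    omega

theorem walk_sound (a : List ℕ) : ∀ (c : List ℕ) (r : ℕ) (k : ℕ → Bool), walk a c r k = true →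
    ∃ j ≤ r, j ≤ a.length ∧ j ≤ c.length ∧ a.take j = c.take j ∧ (j = r ∨ k (r - j) = true) := by
  induction a with
  | nil => exact fun c r k h => ⟨0, by simp, by simp, by simp, by simp, Or.inr h⟩
  | cons x a ih =>
    intro c r k h
    have halted : ∀ (r : ℕ) (k : ℕ → Bool), k r = true → ∃ j ≤ r, j ≤ (x :: a).length ∧ j ≤ c.length ∧
        (x :: a).take j = c.take j ∧ (j = r ∨ k (r - j) = true) :=
      fun r k h => ⟨0, by simp, by simp, by simp, by simp, Or.inr h⟩
    cases r with
    | zero => exact ⟨0, by simp, by simp, by simp, by simp, Or.inl rfl⟩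
    | succ r =>
      cases c with
      | nil => exact halted (r + 1) k h
      | cons y c =>
        rcases Search.of_rec_beq h with ⟨rfl, h'⟩ | ⟨_, h⟩
        · obtain ⟨j, h1, h2, h3, h4, h5⟩ := ih c r k h'
          refine ⟨j + 1, by omega, by simpa using h2, by simpa using h3, by simp [h4], ?_⟩
          rw [Nat.add_sub_add_right]
          exact h5.imp (by omega) id
        · exact halted (r + 1) k h

/-- The square has the root `(c.take i).reverse ++ l :: d.take j`. The part `c.reverse` between the
two letters `l` supplies `j` letters to the first copy and `i` letters to the second. -/
theorem not_squareFreeWord_of_agree {α : Type*} {a b c d : List α} {l : α} {i j : ℕ}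
    (hb : b = c.reverse ++ l :: d) (hij : i + j = c.length) (hac : a.take i = c.take i)
    (hbd : b.take j = d.take j) : ¬ SquareFreeWord (a.reverse ++ [l] ++ b) := by
  have e1 : d.take j = (c.drop i).reverse := by
    rw [← hbd, hb, List.take_append_of_le_length (by simp; omega), List.take_reverse]
    congr 2; omega
  have e2 : c.reverse = d.take j ++ (c.take i).reverse := by
    rw [e1, ← List.reverse_append, List.take_append_drop]
  intro h
  refine h ((c.take i).reverse ++ l :: d.take j) (by simp) ⟨(a.drop i).reverse, d.drop j, ?_⟩
  have e3 : a.reverse = (a.drop i).reverse ++ (c.take i).reverse := by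
    rw [← hac, ← List.reverse_append, List.take_append_drop]
  rw [e3, hb, e2]
  conv_rhs => rw [← List.take_append_drop j d]
  simp

theorem scan_sound (l : ℕ) (a b d : List ℕ) : ∀ (c : List ℕ) (n f : ℕ), n = c.length →
    b = c.reverse ++ d → scan l a b d c n f = true → ¬ SquareFreeWord (a.reverse ++ [l] ++ b) := by
  induction d with
  | nil => exact fun c n f _ _ h => absurd h Bool.false_ne_true
  | cons x d ih =>
    intro c n f hn hb h
    have next : scanNext (scan l a b d) x c n f = true →
        ¬ SquareFreeWord (a.reverse ++ [l] ++ b) := by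
      intro h
      cases f with
      | zero => exact absurd h Bool.false_ne_true
      | succ f => exact ih (x :: c) (n + 1) f (by simp [hn]) (by simp [hb]) h
    rcases Search.of_rec_beq h with ⟨rfl, h⟩ | ⟨_, h⟩
    · obtain ⟨i, hi, _, _, h1, h2⟩ := walk_sound _ _ _ _ h
      rcases h2 with rfl | h2
      · exact not_squareFreeWord_of_agree (j := 0) hb (by omega) h1 (by simp)
      · obtain ⟨j, hj, _, _, h3, h4⟩ := walk_sound _ _ _ _ h2
        rcases h4 with h4 | h4
        · exact not_squareFreeWord_of_agree hb (by omega) h1 h3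
        · rcases hr : n - i - j with _ | r
          · exact not_squareFreeWord_of_agree hb (by omega) h1 h3
          · rw [hr] at h4
            exact next h4
    · exact next h

theorem blockedBy_sound {l f : ℕ} {a b : List ℕ} {other : Bool} (h : blockedBy l f a b other = true) :
    ¬ SquareFreeWord (a.reverse ++ [l] ++ b) ∨ other = true := by
  rcases h1 : scan l a b b [] 0 f
  · rcases h2 : scan l b a a [] 0 f
    · simp only [blockedBy, h1, h2] at h
      exact Or.inr h
    · refine Or.inl fun hs => scan_sound l b a a [] 0 f rfl rfl h2 ?_
      rw [← squareFreeWord_reverse]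
      simpa using hs
  · exact Or.inl (scan_sound l a b b [] 0 f rfl rfl h1)

theorem blockedLetter_sound {l : ℕ} {a b : List ℕ} {other : Bool}
    (h : blockedLetter l a b other = true) :
    ¬ SquareFreeWord (a.reverse ++ [l] ++ b) ∧ other = true := by
  rw [blockedLetter] at h
  rcases hb : blockedBy l 0 a b (blockedBy l 14 a b (blockedBy l 1000 a b false))
  · rw [hb] at h; exact absurd h Bool.false_ne_true
  · rw [hb] at h
    refine ⟨?_, h⟩
    rcases blockedBy_sound hb with h | h
    · exact h
    · rcases blockedBy_sound h with h | h
      · exact h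
      · rcases blockedBy_sound h with h | h
        · exact h
        · exact absurd h Bool.false_ne_true

theorem blocked_sound {a b : List ℕ} (h : blocked a b = true) :
    ∀ l < 3, ¬ SquareFreeWord (a.reverse ++ [l] ++ b) := by
  obtain ⟨h0, h⟩ := blockedLetter_sound h
  obtain ⟨h1, h⟩ := blockedLetter_sound h
  obtain ⟨h2, -⟩ := blockedLetter_sound h
  intro l hl
  interval_cases l
  exacts [h0, h1, h2]

theorem gaps_sound (b : List ℕ) : ∀ a n, gaps b a n = true → ∀ i ≤ n, i ≤ b.length → ∀ l < 3,
    ¬ SquareFreeWord (a.reverse ++ b.take i ++ [l] ++ b.drop i) := by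
  induction b with
  | nil =>
    intro a n h i _ hi l hl
    have := blocked_sound h l hl
    simpa using this
  | cons x b ih =>
    intro a n h i hi hib l hl
    have h : Bool.rec (motive := fun _ => Bool) false
      (Nat.rec (motive := fun _ => Bool) true (gapsStep (gaps b) (x :: a)) n)
      (blocked a (x :: b)) = true := h
    rcases hb : blocked a (x :: b)
    · rw [hb] at h; exact absurd h Bool.false_ne_true
    · rw [hb] at h
      cases i with
      | zero => simpa using blocked_sound hb l hl
      | succ i =>
        cases n with
        | zero => omega
        | succ n =>
          have := ih (x :: a) n h i (by omega) (by simpa using hib) l hl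
          simpa using this

/-- The insertion of any letter between the two words creates a square. -/
def Blocked (w₁ w₂ : List (Fin 3)) : Prop := ∀ l, ¬ SquareFreeWord (w₁ ++ [l] ++ w₂)

theorem gaps_sound_fin {u : List (Fin 3)} {n : ℕ} (h : gaps (u.map Fin.val) [] n = true) :
    ∀ i ≤ n, i ≤ u.length → Blocked (u.take i) (u.drop i) := by
  intro i hi hiu l hs
  refine gaps_sound _ _ _ h i hi (by simpa using hiu) l l.isLt ?_
  rw [← squareFreeWord_map Fin.val_injective] at hs
  simpa [List.map_take, List.map_drop] using hs

theorem squareFree_sound_fin {u : List (Fin 3)} (h : squareFree (u.map Fin.val) = true) :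
    SquareFreeWord u :=
  (squareFreeWord_map Fin.val_injective u).1 (squareFree_sound h)

/-- The word of length `n` with code `c`. -/
def decode : ℕ → ℕ → List (Fin 3)
  | 0, _ => []
  | n + 1, c => ⟨c % 3, Nat.mod_lt _ (by norm_num)⟩ :: decode n (c / 3)

theorem length_decode (n c : ℕ) : (decode n c).length = n := by
  induction n generalizing c with
  | zero => rfl
  | succ n ih => simp [decode, ih]

theorem read_eq (n : ℕ) : ∀ c K, read n c K = K ((decode n c).map Fin.val) := by
  induction n with
  | zero => intro c K; rfl
  | succ n ih =>
    intro c K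
    change force (readRest (read n) c K) (c % 3) = _
    rw [force_eq, readRest, force_eq, readDiv, ih]
    rfl

/-- 1000 is the position up to which `extremalWord` tests the gaps. -/
theorem extremal_sound {n c : ℕ} (hn : n ≤ 1000) (h : extremal n c = true) :
    ExtremalSquareFree (decode n c) := by
  rw [extremal, read_eq, extremalWord] at h
  rcases hs : squareFree ((decode n c).map Fin.val)
  · rw [hs] at h; exact absurd h Bool.false_ne_true
  · rw [hs] at h
    refine ⟨squareFree_sound_fin hs, ?_⟩
    rintro v ⟨w₁, w₂, l, hw, rfl⟩
    have hl := length_decode n c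
    have := gaps_sound_fin h w₁.length (by rw [hw] at hl; simp at hl; omega) (by rw [hw]; simp) l
    rwa [hw, List.take_left, List.drop_left] at this

end Check

/-! ### A square-free morphism whose blocks have length 41 -/

namespace Morphism

/-- The image of the letter `0`, a palindrome. -/
def base : List (Fin 3) :=
  [0, 1, 2, 0, 2, 1, 0, 2, 0, 1, 2, 1, 0, 2, 1, 2, 0, 2, 1, 0, 2, 0, 1, 2, 0, 2, 1, 2, 0, 1, 2, 1,
    0, 2, 0, 1, 2, 0, 2, 1, 0]

/-- The image of a letter. -/
def block (c : Fin 3) : List (Fin 3) := base.map (· + c)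

@[simp] theorem length_block (c : Fin 3) : (block c).length = 41 := rfl

theorem reverse_block (c : Fin 3) : (block c).reverse = block c := by
  rw [block, ← List.map_reverse]; rfl

theorem map_add_block (c d : Fin 3) : (block c).map (· + d) = block (c + d) := by
  simp [block, Function.comp_def, add_assoc]

/-- The image of a word. -/
def image (v : List (Fin 3)) : List (Fin 3) := v.flatMap block

@[simp] theorem image_nil : image [] = [] := rfl

@[simp] theorem image_cons (c : Fin 3) (v : List (Fin 3)) : image (c :: v) = block c ++ image v :=
  rfl

@[simp] theorem image_append (v w : List (Fin 3)) : image (v ++ w) = image v ++ image w := by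
  simp [image]

@[simp] theorem length_image (v : List (Fin 3)) : (image v).length = 41 * v.length := by
  induction v with
  | nil => rfl
  | cons c v ih => simp [ih]; ring

theorem reverse_image (v : List (Fin 3)) : (image v).reverse = image v.reverse := by
  induction v with
  | nil => rfl
  | cons c v ih => simp [ih, reverse_block]

theorem map_add_image (v : List (Fin 3)) (d : Fin 3) :
    (image v).map (· + d) = image (v.map (· + d)) := by
  induction v with
  | nil => rfl
  | cons c v ih => simp [ih, map_add_block]

theorem image_infix {v w : List (Fin 3)} (h : v <:+: w) : image v <:+: image w := by
  obtain ⟨a, b, rfl⟩ := h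
  exact ⟨image a, image b, by simp⟩

/-- The letters of the image of `0`. -/
def letter (y : ℕ) : Fin 3 := base.getD y 0

theorem getElem?_block (c : Fin 3) {y : ℕ} (hy : y < 41) : (block c)[y]? = some (letter y + c) := by
  have : y < base.length := hy
  simp [block, letter, List.getElem?_eq_getElem this]

theorem getElem?_image (v : List (Fin 3)) (i : ℕ) :
    (image v)[i]? = (v[i / 41]?).map (letter (i % 41) + ·) := by
  induction v generalizing i with
  | nil => simp
  | cons c v ih =>
    rw [image_cons]
    by_cases hi : i < 41
    · rw [List.getElem?_append_left (by simpa using hi), getElem?_block c hi,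
        Nat.div_eq_of_lt hi, Nat.mod_eq_of_lt hi]
      rfl
    · obtain ⟨i, rfl⟩ := Nat.exists_eq_add_of_le (not_lt.1 hi)
      rw [List.getElem?_append_right (by simp), length_block, Nat.add_sub_cancel_left, ih,
        Nat.add_mod_left, Nat.add_div_left _ (by norm_num)]
      rfl

theorem squareFreeWord_map_add (u : List (Fin 3)) (d : Fin 3) :
    SquareFreeWord (u.map (· + d)) ↔ SquareFreeWord u :=
  squareFreeWord_map (add_left_injective d) u

/-- Synchronization: 28 consecutive letters of the image of a square-free word determine their
position modulo 41. Adding a constant to all letters lets the first letter be 0. -/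
theorem window_ne_of_zero : ∀ b : Fin 3, b ≠ 0 → ∀ a' b' : Fin 3, a' ≠ b' →
    ∀ y < 41, ∀ y' < 41, y ≠ y' →
      ((image [0, b]).drop y).take 28 ≠ ((image [a', b']).drop y').take 28 := by
  decide +kernel

theorem squareFree_image_three : ∀ b : Fin 3, b ≠ 0 → ∀ c : Fin 3, c ≠ b →
    Check.squareFree ((image [0, b, c]).map Fin.val) = true := by
  decide +kernel

theorem window_injective {a b a' b' : Fin 3} (hab : a ≠ b) (hab' : a' ≠ b') {y y' : ℕ}
    (hy : y < 41) (hy' : y' < 41)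
    (h : ((image [a, b]).drop y).take 28 = ((image [a', b']).drop y').take 28) : y = y' := by
  by_contra hne
  refine window_ne_of_zero (b - a) (sub_ne_zero.2 hab.symm) (a' - a) (b' - a)
    (fun h => hab' (sub_left_injective h)) y hy y' hy' hne ?_
  have := congrArg (List.map (· + -a)) h
  simp only [List.map_take, List.map_drop, map_add_image, List.map_cons, List.map_nil] at this
  simpa only [← sub_eq_add_neg, sub_self] using this

theorem squareFreeWord_image_three {a b c : Fin 3} (hab : b ≠ a) (hbc : c ≠ b) :
    SquareFreeWord (image [a, b, c]) := by
  have := Check.squareFree_sound_fin (squareFree_image_three (b - a) (sub_ne_zero.2 hab) (c - a)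
    (fun h => hbc (sub_left_injective h)))
  rw [← squareFreeWord_map_add _ a, map_add_image] at this
  simpa using this

theorem _root_.SquareFreeWord.getElem_ne {v : List (Fin 3)} (hv : SquareFreeWord v) {j : ℕ}
    (hj : j + 1 < v.length) : v[j] ≠ v[j + 1] := by
  obtain ⟨t, ht, h⟩ := (squareFreeWord_iff v).1 hv j 1 one_pos (by omega)
  obtain rfl : t = 0 := by omega
  simpa [List.getElem?_eq_getElem hj, List.getElem?_eq_getElem (Nat.lt_of_succ_lt hj)] using h

/-- From any place in a block, 42 letters meet at most two blocks. If there is no next block, it is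
not reached, and any other letter may take its place. -/
theorem exists_window {v : List (Fin 3)} (hv : SquareFreeWord v) {s n : ℕ}
    (hs : s + n ≤ 41 * v.length) (hn : 0 < n) (hn' : n ≤ 42) : ∃ a b, a ≠ b ∧
      ((image v).drop s).take n = ((image [a, b]).drop (s % 41)).take n := by
  have hm : s / 41 < v.length := by omega
  have key : ∀ b, (∀ h : s / 41 + 1 < v.length, v[s / 41 + 1] = b) →
      ((image v).drop s).take n = ((image [v[s / 41], b]).drop (s % 41)).take n := by
    intro b hb
    apply List.ext_getElem?
    intro t
    rw [List.getElem?_take, List.getElem?_take]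
    split
    case isFalse => rfl
    case isTrue ht =>
      rw [List.getElem?_drop, List.getElem?_drop, getElem?_image, getElem?_image]
      have e1 : (s + t) % 41 = (s % 41 + t) % 41 := by omega
      rw [e1]
      congr 1
      by_cases hc : s % 41 + t < 41
      · have e2 : (s + t) / 41 = s / 41 := by omega
        have e3 : (s % 41 + t) / 41 = 0 := by omega
        simp [e2, e3, hm]
      · have e2 : (s + t) / 41 = s / 41 + 1 := by omega
        have e3 : (s % 41 + t) / 41 = 1 := by omega
        have e4 : s / 41 + 1 < v.length := by omega
        simp [e2, e3, e4, hb e4]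
  by_cases h1 : s / 41 + 1 < v.length
  · exact ⟨_, _, hv.getElem_ne h1, key v[s / 41 + 1] fun _ => rfl⟩
  · refine ⟨v[s / 41], v[s / 41] + 1, ?_, key _ fun h => absurd h h1⟩
    generalize v[s / 41] = a
    revert a; decide

theorem squareFreeWord_image_of_length_le {v : List (Fin 3)} (hv : SquareFreeWord v)
    (h : v.length ≤ 3) : SquareFreeWord (image v) := by
  match v, h with
  | [], _ => exact fun x hx hu => hx (by simpa using hu)
  | [a], _ =>
    exact (squareFreeWord_image_three (a := a) (b := a + 1) (c := a) (by clear * -; revert a; decide)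
      (by clear * -; revert a; decide)).of_infix (image_infix ⟨[], [a + 1, a], rfl⟩)
  | [a, b], _ =>
    have hab : a ≠ b := hv.getElem_ne (j := 0) (by simp)
    exact (squareFreeWord_image_three (a := a) (b := b) (c := a) hab.symm hab).of_infix
      (image_infix ⟨[], [a], rfl⟩)
  | [a, b, c], _ =>
    have hab : a ≠ b := hv.getElem_ne (j := 0) (by simp)
    have hbc : b ≠ c := hv.getElem_ne (j := 1) (by simp)
    exact squareFreeWord_image_three hab.symm hbc.symm

/-- A square of period less than 28 fits into three consecutive blocks. For a longer period the
halves begin with the same 28 letters, so 41 divides the period by synchronization, and comparing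
letters in steps of 41 gives a square in `v`. -/
theorem squareFreeWord_image {v : List (Fin 3)} (hv : SquareFreeWord v) :
    SquareFreeWord (image v) := by
  rw [squareFreeWord_iff]
  intro s p hp hs
  rw [length_image] at hs
  by_cases hp28 : p < 28
  · set w := (v.drop (s / 41)).take 3 with hw
    have hwv : w <:+: v := (List.take_prefix _ _).isInfix.trans (List.drop_suffix _ _).isInfix
    have hwl : w.length ≤ 3 := by simp [hw]
    have hwl' : w.length = min 3 (v.length - s / 41) := by simp [hw]
    obtain ⟨t, ht, h⟩ := (squareFreeWord_iff _).1
      (squareFreeWord_image_of_length_le (hv.of_infix hwv) hwl) (s % 41) p hp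
      (by rw [length_image, hwl']; omega)
    -- Such a square has at most `2 * 27 = 54` letters, and `40 + 54 ≤ 3 * 41`.
    have key : ∀ i < 54, (image w)[s % 41 + i]? = (image v)[s + i]? := by
      intro i hi
      have e1 : (s % 41 + i) % 41 = (s + i) % 41 := by omega
      have e2 : s / 41 + (s % 41 + i) / 41 = (s + i) / 41 := by omega
      rw [getElem?_image, getElem?_image, hw, List.getElem?_take, if_pos (by omega),
        List.getElem?_drop, e1, e2]
    refine ⟨t, ht, ?_⟩
    rwa [add_assoc, key t (by omega), key (t + p) (by omega), ← add_assoc] at h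
  · by_contra hc
    push Not at hc
    obtain ⟨a, b, hab, h1⟩ := exists_window hv (s := s) (n := 28) (by omega) (by omega)
      (by omega)
    obtain ⟨a', b', hab', h2⟩ := exists_window hv (s := s + p) (n := 28) (by omega) (by omega)
      (by omega)
    have hw : ((image v).drop s).take 28 = ((image v).drop (s + p)).take 28 := by
      apply List.ext_getElem?
      intro t
      rw [List.getElem?_take, List.getElem?_take]
      split
      case isFalse => rfl
      case isTrue ht =>
        rw [List.getElem?_drop, List.getElem?_drop, hc t (by omega)]
        congr 1; omega
    have hmod := window_injective hab hab' (Nat.mod_lt _ (by norm_num))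
      (Nat.mod_lt _ (by norm_num)) (h1.symm.trans (hw.trans h2))
    obtain ⟨q, rfl⟩ : 41 ∣ p := by omega
    obtain ⟨i, hi, h⟩ := (squareFreeWord_iff v).1 hv (s / 41) q (by omega) (by omega)
    have := hc (41 * i) (by omega)
    rw [getElem?_image, getElem?_image] at this
    have e1 : (s + 41 * i) / 41 = s / 41 + i := by omega
    have e2 : (s + 41 * i + 41 * q) / 41 = s / 41 + i + q := by omega
    have e3 : (s + 41 * i + 41 * q) % 41 = (s + 41 * i) % 41 := by omega
    rw [e1, e2, e3] at this
    exact h (Option.map_injective (add_right_injective _) this)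

theorem exists_infix_image_pair {v F : List (Fin 3)} (hv : SquareFreeWord v) (hF : F <:+: image v)
    (h0 : F ≠ []) (h42 : F.length ≤ 42) : ∃ a b, a ≠ b ∧ F <:+: image [a, b] := by
  obtain ⟨A, B, h⟩ := hF
  have hl := congrArg List.length h
  simp only [List.length_append, length_image] at hl
  obtain ⟨a, b, hab, hw⟩ := exists_window hv (s := A.length) (n := F.length) (by omega)
    (List.length_pos_iff.2 h0) h42
  refine ⟨a, b, hab, ?_⟩
  rw [← h, List.append_assoc, List.drop_left, List.take_left] at hw
  rw [hw]
  exact (List.take_prefix _ _).isInfix.trans (List.drop_suffix _ _).isInfix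

end Morphism

/-! ### Capped images of square-free words -/

namespace Morphism

open Check (Blocked)

/-- The marker starts at the last letter of `P`. If a square starts in `P` and its first half
contains the marker, the second half repeats it inside `Y`. If the first half ends before the marker
does, the whole square lies in the prefix treated by `h1`. -/
theorem squareFreeWord_append_of_marker {α : Type*} {P Y : List α} {f : ℕ}
    (hY : SquareFreeWord Y) (h1 : SquareFreeWord ((P ++ Y).take (2 * (P.length - 1 + f))))
    (h2 : ¬ ((P ++ Y).drop (P.length - 1)).take f <:+: Y) : SquareFreeWord (P ++ Y) := by
  rw [squareFreeWord_iff]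
  intro s p hp hs
  by_contra hc
  push Not at hc
  rcases le_or_gt P.length s with hsP | hsP
  · obtain ⟨s, rfl⟩ := Nat.exists_eq_add_of_le hsP
    obtain ⟨t, ht, h⟩ := (squareFreeWord_iff _).1 hY s p hp (by simp at hs; omega)
    have := hc t ht
    rw [List.getElem?_append_right (by omega), List.getElem?_append_right (by omega)] at this
    apply h
    convert this using 2 <;> omega
  · rcases le_or_gt (P.length - 1 + f) (s + p) with hf | hf
    · apply h2
      have e : ((P ++ Y).drop (P.length - 1)).take f = (Y.drop (p - 1)).take f := by
        apply List.ext_getElem?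
        intro t
        rw [List.getElem?_take, List.getElem?_take]
        split
        case isFalse => rfl
        case isTrue ht =>
          have := hc (P.length - 1 + t - s) (by omega)
          rw [show s + (P.length - 1 + t - s) = P.length - 1 + t by omega] at this
          rw [List.getElem?_drop, List.getElem?_drop, this,
            List.getElem?_append_right (by omega)]
          congr 1; omega
      rw [e]
      exact (List.take_prefix _ _).isInfix.trans (List.drop_suffix _ _).isInfix
    · obtain ⟨t, ht, h⟩ := (squareFreeWord_iff _).1 h1 s p hp (by simp at hs ⊢; omega)
      rw [List.getElem?_take, List.getElem?_take, if_pos (by omega), if_pos (by omega)] at h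
      exact h (hc t ht)

/-- A factor that meets both `A` and `B` contains `M` and at least two more letters. -/
theorem infix_append_cases {α : Type*} {F A M B : List α} (h : F <:+: A ++ (M ++ B))
    (hF : F.length ≤ M.length + 1) : F <:+: A ++ M ∨ F <:+: M ++ B := by
  obtain ⟨C, D, h⟩ := h
  rcases le_or_gt A.length C.length with hC | hC
  · right
    have := congrArg (List.drop A.length) h
    rw [List.drop_left, List.append_assoc, List.drop_append_of_le_length hC] at this
    exact ⟨_, _, by rw [← this, List.append_assoc]⟩
  · left
    have hl := congrArg List.length h
    have := congrArg (List.take (A ++ M).length) h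
    simp only [List.length_append] at hl
    rw [← List.append_assoc A, List.take_left, List.take_append, List.length_append,
      List.take_of_length_le (by simp; omega)] at this
    exact ⟨_, _, this⟩

theorem Blocked.append {w₁ w₂ : List (Fin 3)} (h : Blocked w₁ w₂) (a b : List (Fin 3)) :
    Blocked (a ++ w₁) (w₂ ++ b) :=
  fun l hl => h l (hl.of_infix ⟨a, b, by simp⟩)

theorem Blocked.map_add {w₁ w₂ : List (Fin 3)} (h : Blocked w₁ w₂) (d : Fin 3) :
    Blocked (w₁.map (· + d)) (w₂.map (· + d)) := by
  intro l hl
  refine h (l - d) ((squareFreeWord_map_add _ d).1 ?_)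
  simpa using hl

theorem Blocked.reverse {w₁ w₂ : List (Fin 3)} (h : Blocked w₁ w₂) :
    Blocked w₂.reverse w₁.reverse := by
  intro l hl
  refine h l ((squareFreeWord_reverse _).1 ?_)
  simpa using hl

theorem Blocked.take_drop {A S B : List (Fin 3)} {i : ℕ} (hi : i ≤ S.length)
    (h : Blocked (S.take i) (S.drop i)) :
    Blocked ((A ++ S ++ B).take (A.length + i)) ((A ++ S ++ B).drop (A.length + i)) := by
  rw [List.append_assoc, List.take_length_add_append, List.drop_length_add_append,
    List.take_append_of_le_length hi, List.drop_append_of_le_length hi]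
  exact Blocked.append h A B

/-- `K` can precede an image that begins with `image [2, y]`. Its letters from position `l` on form
the end of `image [0]`. -/
structure IsCap (K : List (Fin 3)) (l : ℕ) : Prop where
  le : l ≤ K.length
  suffix : K.drop l <:+ block 0
  squareFree : ∀ y, y ≠ 2 → SquareFreeWord (K ++ image [2, y])
  blocked : ∀ y, y ≠ 2 → ∀ i ≤ K.length + 41,
    Blocked ((K ++ image [2, y]).take i) ((K ++ image [2, y]).drop i)

/-- A factor of a word that begins with a cap. -/
def marker (K : List (Fin 3)) (l f : ℕ) : List (Fin 3) := ((K ++ block 2).drop (l - 1)).take f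

/-- The factor occurs in no image, and in no cap `K'` at the other end. -/
structure IsMarker (K : List (Fin 3)) (l f : ℕ) (K' : List (Fin 3)) : Prop where
  pos : 0 < f
  le : f ≤ 42
  le_length : l - 1 + f ≤ K.length + 41
  -- So the prefix to be checked in `squareFreeWord_append_of_marker` lies inside the cap followed
  -- by two blocks.
  two_mul_le : 2 * (l - 1 + f) ≤ K.length + 82
  not_infix_pair : ∀ a b, a ≠ b → ¬ marker K l f <:+: image [a, b]
  not_infix_cap : ∀ d, ¬ (marker K l f).map (· + d) <:+: (K' ++ block 2).reverse

variable {K K' : List (Fin 3)} {l l' f f' : ℕ}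

theorem length_marker (h : IsMarker K l f K') : (marker K l f).length = f := by
  have := h.le_length
  simp [marker]; omega

theorem IsCap.map_append_eq (x y : Fin 3) (v R : List (Fin 3)) :
    K.map (· + x) ++ image ((2 + x) :: (y + x) :: v) ++ R =
      [] ++ (K ++ image [2, y]).map (· + x) ++ (image v ++ R) := by
  simp [map_add_block]

/-- Only the first `l` letters of the cap are foreign to the image, the others continue it to the
left; these `l` letters play the role of `P` in `squareFreeWord_append_of_marker`. -/
theorem IsCap.squareFreeWord_append (hK : IsCap K l) (hM : IsMarker K l f K') {x y : Fin 3}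
    (hy : y ≠ 2) {v R : List (Fin 3)}
    (hY : SquareFreeWord ((K.drop l).map (· + x) ++ image ((2 + x) :: (y + x) :: v) ++ R))
    (hF : ¬ (marker K l f).map (· + x) <:+:
      (K.drop l).map (· + x) ++ image ((2 + x) :: (y + x) :: v) ++ R) :
    SquareFreeWord (K.map (· + x) ++ image ((2 + x) :: (y + x) :: v) ++ R) := by
  have hl := hK.le
  have h1 := hM.le_length
  have h2 := hM.two_mul_le
  have e : K.map (· + x) ++ image ((2 + x) :: (y + x) :: v) ++ R = (K.take l).map (· + x) ++
      ((K.drop l).map (· + x) ++ image ((2 + x) :: (y + x) :: v) ++ R) := by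
    rw [← List.append_assoc, ← List.append_assoc, ← List.map_append, List.take_append_drop]
  have hP : ((K.take l).map (· + x)).length = l := by simpa using hl
  rw [e]
  refine squareFreeWord_append_of_marker (f := f) hY ?_ ?_
  · rw [← e, hP, IsCap.map_append_eq, List.nil_append, List.take_append_of_le_length]
    · exact ((squareFreeWord_map_add _ x).2 (hK.squareFree y hy)).of_infix
        (List.take_prefix _ _).isInfix
    · simp; omega
  · rw [← e, hP]
    convert hF using 1
    have e' : K.map (· + x) ++ image ((2 + x) :: (y + x) :: v) ++ R =
        (K ++ block 2).map (· + x) ++ (image ((y + x) :: v) ++ R) := by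
      simp [map_add_block]
    rw [e', List.drop_append_of_le_length (by simp; omega),
      List.take_append_of_le_length (by simp; omega), marker]
    simp only [List.map_take, List.map_drop]

theorem IsCap.blocked_append (hK : IsCap K l) {x y : Fin 3} (hy : y ≠ 2) (v R : List (Fin 3))
    {i : ℕ} (hi : i ≤ K.length + 41) :
    Blocked ((K.map (· + x) ++ image ((2 + x) :: (y + x) :: v) ++ R).take i)
      ((K.map (· + x) ++ image ((2 + x) :: (y + x) :: v) ++ R).drop i) := by
  rw [IsCap.map_append_eq]
  have := Blocked.take_drop (A := []) (B := image v ++ R) (i := i)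
    (S := (K ++ image [2, y]).map (· + x)) (by simp; omega)
    (by rw [← List.map_take, ← List.map_drop]; exact Blocked.map_add (hK.blocked y hy i hi) x)
  simpa using this

/-- These are the gaps inside the middle block and at its two ends. The left context is expected in
reverse, but `block 0` is a palindrome. -/
theorem gaps_image_three : ∀ b : Fin 3, b ≠ 0 → ∀ c : Fin 3, c ≠ b →
    Check.gaps ((image [b, c]).map Fin.val) ((block 0).map Fin.val) 41 = true := by
  decide +kernel

theorem blocked_image_three {a b c : Fin 3} (hab : b ≠ a) (hbc : c ≠ b) {i : ℕ} (hi : i ≤ 41) :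
    Blocked ((image [a, b, c]).take (41 + i)) ((image [a, b, c]).drop (41 + i)) := by
  have e : image [a, b, c] = (block 0 ++ image [b - a, c - a]).map (· + a) := by
    rw [List.map_append, map_add_image, map_add_block]
    simp
  rw [e, ← List.map_take, ← List.map_drop]
  refine Blocked.map_add ?_ a
  intro l h
  rw [← squareFreeWord_map Fin.val_injective] at h
  refine Check.gaps_sound _ _ _ (gaps_image_three (b - a) (sub_ne_zero.2 hab) (c - a)
    (fun h => hbc (sub_left_injective h))) i hi (by simp; omega) l l.isLt ?_
  rw [← List.map_reverse, reverse_block]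
  have h41 : 41 + i = (block 0).length + i := by simp
  rw [h41, List.take_length_add_append, List.drop_length_add_append] at h
  simpa [List.map_take, List.map_drop] using h

theorem IsCap.suffix_block (hK : IsCap K l) (x : Fin 3) :
    (K.drop l).map (· + x) <:+ block x := by
  have := hK.suffix.map (· + x)
  rwa [map_add_block, zero_add] at this

theorem infix_image_of_suffix_of_prefix {A B : List (Fin 3)} {x z : Fin 3} (hA : A <:+ block x)
    (hB : B <+: block z) (v : List (Fin 3)) : A ++ image v ++ B <:+: image (x :: v ++ [z]) := by
  obtain ⟨A', hA⟩ := hA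
  obtain ⟨B', hB⟩ := hB
  exact ⟨A', B', by simp [← hA, ← hB]⟩

theorem IsMarker.not_infix_image (hM : IsMarker K l f K') {v : List (Fin 3)}
    (hv : SquareFreeWord v) (x : Fin 3) : ¬ (marker K l f).map (· + x) <:+: image v := by
  intro h
  have hl := length_marker hM
  have h0 := hM.pos
  obtain ⟨a, b, hab, h⟩ := exists_infix_image_pair hv h
    (by rw [← List.length_pos_iff, List.length_map]; omega) (by simpa [hl] using hM.le)
  refine hM.not_infix_pair (a - x) (b - x) (fun h => hab (sub_left_injective h)) ?_
  have := h.map (· + -x)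
  rw [map_add_image, List.map_map] at this
  simpa [Function.comp_def, add_assoc, ← sub_eq_add_neg] using this

theorem exists_eq_cons_cons {x : Fin 3} {v : List (Fin 3)} (hv : SquareFreeWord v)
    (h : 2 ≤ v.length) (hx : v.head? = some (2 + x)) :
    ∃ y, y ≠ 2 ∧ ∃ w, v = (2 + x) :: (y + x) :: w := by
  match v, h, hx with
  | a :: b :: w, _, hx =>
    obtain rfl : a = 2 + x := by simpa using hx
    refine ⟨b - x, ?_, w, by simp⟩
    have : 2 + x ≠ b := hv.getElem_ne (j := 0) (by simp)
    exact fun h => this (by rw [← h]; simp)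

theorem squareFreeWord_capped (hK : IsCap K l) (hK' : IsCap K' l') (hM : IsMarker K l f K')
    (hM' : IsMarker K' l' f' K) {x z : Fin 3} {v : List (Fin 3)}
    (hv : SquareFreeWord (x :: v ++ [z])) (h2 : 2 ≤ v.length) (hx : v.head? = some (2 + x))
    (hz : v.getLast? = some (2 + z)) :
    SquareFreeWord (K.map (· + x) ++ image v ++ (K'.map (· + z)).reverse) := by
  have hv' : SquareFreeWord v := hv.of_infix ⟨[x], [z], rfl⟩
  obtain ⟨y, hy, w, hw⟩ := exists_eq_cons_cons hv' h2 hx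
  obtain ⟨y', hy', w', hw'⟩ := exists_eq_cons_cons ((squareFreeWord_reverse v).2 hv') (by simpa)
    (by rwa [List.head?_reverse])
  have hB : ((K'.drop l').map (· + z)).reverse <+: block z := by
    have := List.reverse_prefix.2 (hK'.suffix_block z)
    rwa [reverse_block] at this
  -- The left cap is attached first, while the right end is still a part of an image. Then the word
  -- is reversed and the other cap is completed.
  have h1 : SquareFreeWord (K.map (· + x) ++ image v ++ ((K'.drop l').map (· + z)).reverse) := by
    have hi := infix_image_of_suffix_of_prefix (hK.suffix_block x) hB v
    rw [hw]
    apply hK.squareFreeWord_append hM hy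
    · rw [← hw]
      exact (squareFreeWord_image hv).of_infix hi
    · rw [← hw]
      exact fun h => hM.not_infix_image hv x (h.trans hi)
  rw [← squareFreeWord_reverse] at h1 ⊢
  simp only [List.reverse_append, List.reverse_reverse, reverse_image, ← List.append_assoc,
    hw'] at h1 ⊢
  apply hK'.squareFreeWord_append hM' hy' h1
  intro h
  rw [← hw', hw, List.reverse_cons, image_append, image_cons, image_nil, List.append_nil,
    ← List.append_assoc, List.append_assoc] at h
  -- A marker has at most 42 letters, so it cannot reach across the block next to the cap `K`: it
  -- lies in the image, or in this block and the cap.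
  rcases infix_append_cases h
    (by rw [List.length_map, length_marker hM', length_block]; exact hM'.le) with h | h
  · have hv2 : SquareFreeWord (z :: v.reverse) := by
      rw [← squareFreeWord_reverse]
      exact hv.of_infix ⟨[x], [], by simp⟩
    refine hM'.not_infix_image hv2 z (h.trans ?_)
    obtain ⟨A', hA⟩ := hK'.suffix_block z
    exact ⟨A', [], by rw [image_cons, ← hA, hw]; simp⟩
  · refine hM'.not_infix_cap (z - x) ?_
    have := h.map (· + -x)
    rw [List.map_append, map_add_block, ← List.map_reverse, List.map_map, List.map_map] at this
    rw [List.reverse_append, reverse_block]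
    simpa [Function.comp_def, add_assoc, sub_eq_add_neg] using this

theorem extremalSquareFree_capped (hK : IsCap K l) (hK' : IsCap K' l') (hM : IsMarker K l f K')
    (hM' : IsMarker K' l' f' K) {x z : Fin 3} {v : List (Fin 3)}
    (hv : SquareFreeWord (x :: v ++ [z])) (h2 : 2 ≤ v.length) (hx : v.head? = some (2 + x))
    (hz : v.getLast? = some (2 + z)) :
    ExtremalSquareFree (K.map (· + x) ++ image v ++ (K'.map (· + z)).reverse) := by
  refine ⟨squareFreeWord_capped hK hK' hM hM' hv h2 hx hz, ?_⟩
  set X := K.map (· + x) ++ image v ++ (K'.map (· + z)).reverse with hX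
  have hv' : SquareFreeWord v := hv.of_infix ⟨[x], [z], rfl⟩
  have hXl : X.length = K.length + 41 * v.length + K'.length := by simp [hX, add_assoc]
  suffices h : ∀ i ≤ X.length, Blocked (X.take i) (X.drop i) by
    rintro _ ⟨w₁, w₂, l, hw, rfl⟩
    have := h w₁.length (by rw [hw]; simp) l
    rwa [hw, List.take_left, List.drop_left] at this
  intro i hi
  rcases le_or_gt i (K.length + 41) with hiK | hiK
  · obtain ⟨y, hy, w, hw⟩ := exists_eq_cons_cons hv' h2 hx
    rw [hX, hw]
    exact hK.blocked_append hy _ _ hiK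
  rcases le_or_gt (X.length - i) (K'.length + 41) with hiK' | hiK'
  · obtain ⟨y, hy, w, hw⟩ := exists_eq_cons_cons ((squareFreeWord_reverse v).2 hv') (by simpa)
      (by rwa [List.head?_reverse])
    have hXr : X.reverse = K'.map (· + z) ++ image ((2 + z) :: (y + z) :: w) ++
        (K.map (· + x)).reverse := by
      simp only [hX, List.reverse_append, List.reverse_reverse, reverse_image, hw,
        List.append_assoc]
    have := Blocked.reverse (hK'.blocked_append (x := z) hy w (K.map (· + x)).reverse hiK')
    rw [← hXr, List.take_reverse, List.drop_reverse, List.reverse_reverse, List.reverse_reverse,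
      Nat.sub_sub_self hi] at this
    exact this
  -- The gap is at block `j + 1` of `image v`, which has a neighbour on each side.
  · obtain ⟨j, r, hr, hij⟩ : ∃ j r, r < 41 ∧ i = K.length + 41 * j + (41 + r) :=
      ⟨(i - K.length - 41) / 41, (i - K.length - 41) % 41, Nat.mod_lt _ (by norm_num), by omega⟩
    have hj : j + 2 < v.length := by omega
    have e : v = v.take j ++ [v[j], v[j + 1], v[j + 2]] ++ v.drop (j + 3) := by
      conv_lhs => rw [← List.take_append_drop j v, List.drop_eq_getElem_cons (by omega),
        List.drop_eq_getElem_cons (by omega), List.drop_eq_getElem_cons (by omega)]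
      simp
    have := Blocked.take_drop (A := K.map (· + x) ++ image (v.take j))
      (B := image (v.drop (j + 3)) ++ (K'.map (· + z)).reverse) (i := 41 + r) (by simp; omega)
      (blocked_image_three (hv'.getElem_ne (j := j) (by omega)).symm
        (hv'.getElem_ne (j := j + 1) (by omega)).symm hr.le)
    have e2 : (K.map (· + x) ++ image (v.take j)).length + (41 + r) = i := by
      simp; omega
    have e3 : K.map (· + x) ++ image (v.take j) ++ image [v[j], v[j + 1], v[j + 2]] ++
        (image (v.drop (j + 3)) ++ (K'.map (· + z)).reverse) = X := by
      rw [hX]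
      conv_rhs => rw [e]
      simp only [image_append, List.append_assoc]
    rwa [e2, e3] at this

end Morphism

namespace Morphism

open Check (decode length_decode)

/-! ### Square-free words with given length and prescribed ends -/

theorem iterate_image (m : ℕ) :
    SquareFreeWord (image^[m] [0]) ∧ (image^[m] [0]).length = 41 ^ m := by
  induction m with
  | zero => exact ⟨SquareFreeWord.singleton 0, rfl⟩
  | succ m ih =>
    rw [Function.iterate_succ_apply']
    exact ⟨squareFreeWord_image ih.1, by rw [length_image, ih.2, pow_succ']⟩

/-- The bounds on the positions keep each of the two pairs of letters within one block. For `r = 0`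
both pairs would coincide and give `letter i = 4 + letter i`, which is impossible modulo 3. -/
theorem exists_letter_eq : ∀ r < 41, r ≠ 0 →
    ∃ i < 40, letter (i + 1) = 2 + letter i ∧ (i + r) % 41 ≠ 40 ∧
      letter ((i + r) % 41) = 2 + letter ((i + r) % 41 + 1) := by
  decide +kernel

theorem cons_image_append_infix (x z : Fin 3) (v : List (Fin 3)) :
    x :: image v ++ [z] <:+: image (x :: v ++ [z]) := by
  have h1 : [x] <:+ block x := ⟨(block x).take 40, by revert x; decide⟩
  have h2 : [z] <+: block z := ⟨(block z).drop 1, by revert z; decide⟩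
  exact infix_image_of_suffix_of_prefix h1 h2 v

/-- If 41 does not divide `k`, a factor of a long image works, with its ends chosen by
`exists_letter_eq`. Otherwise the image of a solution for `k / 41` works, because a block begins and
ends with the letter that it encodes. -/
theorem exists_squareFreeWord_with_ends {k : ℕ} (hk : 0 < k) :
    ∃ (x z : Fin 3) (v : List (Fin 3)),
    SquareFreeWord (x :: v ++ [z]) ∧ v.length = k ∧ v.head? = some (2 + x) ∧
      v.getLast? = some (2 + z) := by
  induction k using Nat.strong_induction_on with | _ k ih => ?_
  by_cases hk41 : k % 41 = 0
  · obtain ⟨x, z, v, hv, hvl, hx, hz⟩ := ih (k / 41) (by omega) (by omega)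
    refine ⟨x, z, image v, (squareFreeWord_image hv).of_infix (cons_image_append_infix x z v),
      by rw [length_image]; omega, ?_, ?_⟩
    · obtain ⟨w, rfl⟩ := List.head?_eq_some_iff.1 hx
      have h0 : ∀ a, (block a).head? = some a := by decide
      rw [image_cons, List.head?_append, h0, Option.some_or]
    · obtain ⟨w, rfl⟩ := List.getLast?_eq_some_iff.1 hz
      have h0 : ∀ a, (block a).getLast? = some a := by decide
      rw [image_append, List.getLast?_append, image_cons, image_nil, List.append_nil, h0,
        Option.some_or]
  obtain ⟨u, hu, hul⟩ : ∃ u : List (Fin 3), SquareFreeWord u ∧ k + 41 < u.length :=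
    ⟨_, (iterate_image (k + 41)).1, by
      rw [(iterate_image _).2]; exact Nat.lt_pow_self (by norm_num)⟩
  obtain ⟨i, hi, h1, hne, h2⟩ := exists_letter_eq (k % 41) (Nat.mod_lt _ (by norm_num)) hk41
  have hlast : (i + k) % 41 = (i + k % 41) % 41 := by omega
  rw [← hlast] at hne h2
  have key : ∀ j (hj : j < u.length), (image u)[j]? = some (letter (j % 41) + u[j / 41]'(by omega)) := by
    intro j hj
    rw [getElem?_image, List.getElem?_eq_getElem (by omega)]
    rfl
  refine ⟨letter i + u[0], letter ((i + k) % 41 + 1) + u[(i + k) / 41],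
    ((image u).drop (i + 1)).take k, ?_, ?_, ?_, ?_⟩
  · refine (squareFreeWord_image hu).of_infix ?_
    have e : (letter i + u[0]) :: ((image u).drop (i + 1)).take k ++
        [letter ((i + k) % 41 + 1) + u[(i + k) / 41]] = ((image u).drop i).take (k + 2) := by
      apply List.ext_getElem?
      intro t
      have hl : (((image u).drop (i + 1)).take k).length = k := by simp; omega
      rw [List.getElem?_take, List.getElem?_drop]
      rcases lt_trichotomy t (k + 1) with ht | rfl | ht
      · rw [List.getElem?_append_left (by simp [hl]; omega), if_pos (by omega)]
        cases t with
        | zero =>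
          rw [key _ (by omega)]
          have e1 : i % 41 = i := by omega
          have e2 : i / 41 = 0 := by omega
          simp [e1, e2]
        | succ t =>
          rw [List.getElem?_cons_succ, List.getElem?_take, if_pos (by omega), List.getElem?_drop]
          congr 1; omega
      · rw [List.getElem?_append_right (by simp [hl]), if_pos (by omega), key _ (by omega)]
        have e1 : (i + (k + 1)) % 41 = (i + k) % 41 + 1 := by omega
        have e2 : (i + (k + 1)) / 41 = (i + k) / 41 := by omega
        simp [e1, e2, hl]
      · rw [if_neg (by omega), List.getElem?_eq_none (by simp [hl]; omega)]
    rw [e]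
    exact (List.take_prefix _ _).isInfix.trans (List.drop_suffix _ _).isInfix
  · simp; omega
  · rw [List.head?_eq_getElem?, List.getElem?_take, if_pos hk, List.getElem?_drop,
      key _ (by omega)]
    have e1 : (i + 1 + 0) % 41 = i + 1 := by omega
    have e2 : (i + 1 + 0) / 41 = 0 := by omega
    simp [e1, e2, h1, add_assoc]
  · have hl : (((image u).drop (i + 1)).take k).length = k := by simp; omega
    rw [List.getLast?_eq_getElem?, hl, List.getElem?_take, if_pos (by omega), List.getElem?_drop,
      key _ (by omega)]
    have e1 : i + 1 + (k - 1) = i + k := by omega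
    simp [e1, h2, add_assoc]

/-! ### The caps -/

/-- Lets a cap followed by an image be read from a single number. -/
theorem decode_append (m d : ℕ) (n c : ℕ) :
    decode (n + m) (c % 3 ^ n + 3 ^ n * d) = decode n c ++ decode m d := by
  induction n generalizing c with
  | zero => simp [decode, Nat.mod_one]
  | succ n ih =>
    have e0 : c % 3 ^ (n + 1) = c % 3 + 3 * (c / 3 % 3 ^ n) := by
      rw [pow_succ', Nat.mod_mul]
    have e : c % 3 ^ (n + 1) + 3 ^ (n + 1) * d = c % 3 + 3 * (c / 3 % 3 ^ n + 3 ^ n * d) := by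
      rw [e0, pow_succ']; ring
    have e1 : (c % 3 ^ (n + 1) + 3 ^ (n + 1) * d) % 3 = c % 3 := by omega
    have e2 : (c % 3 ^ (n + 1) + 3 ^ (n + 1) * d) / 3 = c / 3 % 3 ^ n + 3 ^ n * d := by omega
    rw [Nat.add_right_comm, decode, decode]
    simp only [e1, e2, ih, List.cons_append]

/-- The code of `image [2, y]`. -/
def tail (y : Fin 3) : ℕ := (image [2, y]).foldr (fun x c => x.val + 3 * c) 0

theorem decode_tail : ∀ y, decode 82 (tail y) = image [2, y] := by decide +kernel

def capWord (n : ℕ) (u : List ℕ) : Bool :=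
  Bool.rec (motive := fun _ => Bool) false (Check.gaps u [] (n + 41)) (Check.squareFree u)

/-- Lengths of the caps, their codes, and the lengths of the parts before the image. -/
def caps : List (ℕ × ℕ × ℕ) :=
  [(31, 120476373327529, 24),
    (35, 9759271946397095, 28),
    (47, 5188080862441337777161, 34),
    (49, 46675015467500000830669, 42),
    (50, 140071946108114756182215, 40),
    (52, 909084302197817471166071, 50),
    (55, 34156028449334413962357717, 49),
    (57, 220975894541519684110749269, 55),
    (58, 662812449200264616342653109, 56),
    (60, 5965429249618562850063609925, 58)]

theorem caps_suffix : ∀ q ∈ caps, q.2.2 ≤ q.1 ∧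
    (decode q.1 q.2.1).drop q.2.2 = (block 0).drop (41 + q.2.2 - q.1) := by
  decide +kernel

theorem caps_capWord : ∀ q ∈ caps, ∀ y : Fin 3, y ≠ 2 →
    Check.read (q.1 + 82) (q.2.1 % 3 ^ q.1 + 3 ^ q.1 * tail y) (capWord q.1) = true := by
  decide +kernel

theorem isCap_of_mem {q : ℕ × ℕ × ℕ} (hq : q ∈ caps) : IsCap (decode q.1 q.2.1) q.2.2 := by
  have hw : ∀ y : Fin 3, y ≠ 2 → SquareFreeWord (decode q.1 q.2.1 ++ image [2, y]) ∧
      ∀ i ≤ q.1 + 41, Check.Blocked ((decode q.1 q.2.1 ++ image [2, y]).take i)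
        ((decode q.1 q.2.1 ++ image [2, y]).drop i) := by
    intro y hy
    have h := caps_capWord q hq y hy
    rw [Check.read_eq, decode_append, decode_tail, capWord] at h
    rcases hs : Check.squareFree ((decode q.1 q.2.1 ++ image [2, y]).map Fin.val)
    · rw [hs] at h; exact absurd h Bool.false_ne_true
    · rw [hs] at h
      exact ⟨Check.squareFree_sound_fin hs, fun i hi => Check.gaps_sound_fin h i hi
        (by simp [length_decode]; omega)⟩
  obtain ⟨h1, h2⟩ := caps_suffix q hq
  refine ⟨by rwa [length_decode], by rw [h2]; exact List.drop_suffix _ _, fun y hy => (hw y hy).1,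
    ?_⟩
  rw [length_decode]
  exact fun y hy => (hw y hy).2

theorem isMarker_iff (K : List (Fin 3)) (l f : ℕ) (K' : List (Fin 3)) : IsMarker K l f K' ↔
    (0 < f ∧ f ≤ 42 ∧ l - 1 + f ≤ K.length + 41 ∧ 2 * (l - 1 + f) ≤ K.length + 82) ∧
      (∀ a b, a ≠ b → ¬ marker K l f <:+: image [a, b]) ∧
      ∀ d, ¬ (marker K l f).map (· + d) <:+: (K' ++ block 2).reverse :=
  ⟨fun h => ⟨⟨h.1, h.2, h.3, h.4⟩, h.5, h.6⟩, fun h => ⟨h.1.1, h.1.2.1, h.1.2.2.1, h.1.2.2.2, h.2.1,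
    h.2.2⟩⟩

instance (K : List (Fin 3)) (l f : ℕ) (K' : List (Fin 3)) : Decidable (IsMarker K l f K') :=
  decidable_of_iff' _ (isMarker_iff K l f K')

/-- Pairs of indices of caps, and the lengths of their markers. -/
def pairs : List (ℕ × ℕ × ℕ × ℕ) :=
  [(0, 3, 19, 19), (0, 4, 19, 12), (1, 2, 19, 15), (0, 5, 19, 8), (1, 3, 19, 19),
    (1, 4, 19, 12), (0, 6, 19, 12), (1, 5, 19, 8), (0, 7, 19, 8), (0, 8, 19, 8),
    (1, 6, 19, 12), (0, 9, 26, 8), (1, 7, 19, 8), (1, 8, 19, 8), (2, 2, 10, 10),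
    (1, 9, 26, 8), (2, 3, 15, 19), (2, 4, 26, 12), (3, 3, 19, 19), (2, 5, 8, 16),
    (4, 4, 12, 12), (3, 5, 19, 8), (4, 5, 12, 8), (0, 0, 19, 19), (5, 5, 15, 15),
    (4, 6, 12, 12), (3, 7, 19, 8), (4, 7, 12, 8), (4, 8, 12, 8), (5, 7, 8, 15),
    (6, 6, 12, 12), (1, 1, 19, 19), (6, 7, 12, 8), (6, 8, 19, 8), (7, 7, 8, 8),
    (7, 8, 8, 8), (8, 8, 8, 8), (7, 9, 13, 8), (8, 9, 13, 8), (0, 2, 19, 13),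
    (9, 9, 13, 13)]
def cap (i : ℕ) : ℕ × ℕ × ℕ := caps.getD i (0, 0, 0)

/-- Since `162 = 80 + 2 * 41`, the condition on lengths leaves, for `n ≥ 162` with `n - 162`
congruent to `r`, a multiple of 41 that amounts to at least two blocks. -/
def IsPair (r : ℕ) (q q' : ℕ × ℕ × ℕ) (f f' : ℕ) : Prop :=
  (q.1 + q'.1 ≤ r + 80 ∧ (q.1 + q'.1) % 41 = (r + 80) % 41) ∧
    IsMarker (decode q.1 q.2.1) q.2.2 f (decode q'.1 q'.2.1) ∧
    IsMarker (decode q'.1 q'.2.1) q'.2.2 f' (decode q.1 q.2.1)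

instance (r : ℕ) (q q' : ℕ × ℕ × ℕ) (f f' : ℕ) : Decidable (IsPair r q q' f f') :=
  inferInstanceAs (Decidable (_ ∧ _))

set_option maxRecDepth 4000 in
theorem isPair_pairs : ∀ r < 41, ∀ p ∈ pairs[r]?, (p.1 < 10 ∧ p.2.1 < 10) ∧
    IsPair r (cap p.1) (cap p.2.1) p.2.2.1 p.2.2.2 := by
  decide +kernel

theorem exists_isPair {r : ℕ} (hr : r < 41) : ∃ p : ℕ × ℕ × ℕ × ℕ, (p.1 < 10 ∧ p.2.1 < 10) ∧
    IsPair r (cap p.1) (cap p.2.1) p.2.2.1 p.2.2.2 := by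
  have hl : pairs.length = 41 := rfl
  exact ⟨_, isPair_pairs r hr _ (List.getElem?_eq_getElem (hl ▸ hr))⟩

theorem exists_extremalSquareFree {n : ℕ} (hn : 162 ≤ n) :
    ∃ u : List (Fin 3), u.length = n ∧ ExtremalSquareFree u := by
  have hr : (n - 162) % 41 < 41 := Nat.mod_lt _ (by norm_num)
  have hcap : ∀ i < 10, cap i ∈ caps := by decide +kernel
  obtain ⟨p, ⟨h1, h2⟩, ⟨h3, h4⟩, hM, hM'⟩ := exists_isPair hr
  obtain ⟨k, hk, hnk⟩ : ∃ k, 2 ≤ k ∧ n = (cap p.1).1 + 41 * k + (cap p.2.1).1 :=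
    ⟨(n - (cap p.1).1 - (cap p.2.1).1) / 41, by omega, by omega⟩
  obtain ⟨x, z, v, hv, hvl, hx, hz⟩ := exists_squareFreeWord_with_ends (k := k) (by omega)
  refine ⟨_, ?_, extremalSquareFree_capped (isCap_of_mem (hcap _ h1)) (isCap_of_mem (hcap _ h2))
    hM hM' hv (by omega) hx hz⟩
  simp [length_decode, hvl, hnk]; ring

end Morphism

/-! ### Explicit extremal square-free words -/

/-- Lengths and codes of extremal square-free words. -/
def extremalWords : List (ℕ × ℕ) :=
  [(25, 685897848129),
    (41, 21075482895171963150),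
    (48, 19507836457313333099814),
    (50, 175529400595556614975290),
    (63, 661371109997769677270392350078),
    (71, 5673366902332181460121376035375524),
    (72, 5508301043106375843116998685945802),
    (77, 1042759251926674095156881052809607123),
    (79, 39884777828734355531836691424726254646),
    (81, 380081146611251324253299159506220058873),
    (83, 1070810376535856826088255721995261222890),
    (84, 4751023119895320043116275381502956377128),
    (85, 20754526226510932676329370434125777041142),
    (87, 261684027334326106644380532437628956993526),
    (88, 386308934745860384275464491197694960361558),
    (89, 1158998584287815604667210489204085143021083),
    (90, 6386101274603793547236917146469023267303224),
    (91, 3684683972112936424093430496377076224993628),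
    (92, 63589216583503994422308765519699850909867221),
    (93, 33162155749014756485724710125856074403404914),
    (94, 189673525603997575311735791983655236443852201),
    (95, 1817742510513746180660292852319923120431225772),
    (96, 2686084006490313126966116976348171105977564742),
    (97, 11513390889826961336079129107767295373980230029),
    (98, 8058252019474982231244608639615166620621577018),
    (99, 139069616668123235801589270191583815028397654251),
    (100, 205313122210833670919982711458791280813501814696),
    (101, 217572805221686309353814422776372464620858720434),
    (102, 652730711607890348718879307069465132011692243811),
    (103, 1958192134823671046156551468003194081243118738350),
    (104, 33793916850353946299786192656554736316058493240611),
    (105, 17623729213413039415409731167825574936782399110586),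
    (106, 52870191499775358419195877284515108197898167076218),
    (107, 968517074920191426238059525778220713427696220722031),
    (108, 826766436171131316351439914963897650871572923768836),
    (109, 6103247837651800367143998507457007126959873686647256),
    (110, 5796761041561647167863372643549165694528935560213818),
    (111, 12847456534445410022026266417641609574356097934606446),
    (112, 109105053810271241684124200451379827455489905179489333),
    (113, 115629287369202951604503246192103220273490846988331835),
    (114, 1862181023246564719768291582968095820427805555923076493),
    (115, 2934580586289296025780524818411579748492518367269292754),
    (116, 5410905172411895383962606046172759284225418829016480071),
    (117, 40043409062833462208831774207425423383096992784516423705),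
    (118, 28539752872867933496096447444718951143216085395528263788),
    (119, 238627530615113825656453910070649674706858174979271574530),
    (120, 1081127708069089733443816739996904100298169653262085908408),
    (121, 758643754429340565477145798266417225859006690867830986235),
    (122, 9755182971498362675354616535187095066928562289074654374673),
    (123, 36653309080562133379199283227561030055152872488462266178450),
    (124, 84108847959999918946154766516874740650323266048415168572612),
    (125, 262724806861250345552145270574918230814144002902989641745305),
    (126, 756979631639999270515392898651872665864355095145460328232003),
    (127, 553051296978961398623605984990257685412411360348018305543242),
    (128, 2875576855731750094748441276114070887869201122108942605784402),
    (129, 5055731602169935815032978753769622236282660299857932001131615),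
    (130, 14932103678943261040044638350554138987109888264612487781584667),
    (131, 77640575104757252558208725634170628911246660653783358076249081),
    (132, 403166799331265768687428552841803552541126926434295843632367557),
    (133, 2166249676447660437655693503438467967085487497439686335669095367),
    (134, 3628501193981391918187223436737551138135890925531426481844560394),
    (135, 22101618715258175119121207894279255864850401136069161431711379013),
    (136, 46540911361049914963525878767279504085237663685209321088375545021),
    (137, 44184552775089387753646808867507267061539918560930203654052669716),
    (138, 419927864213609897584139671872665299569161254940252597654180027334),
    (139, 1794687222795887313813673291053232770330466318765554576897926667852),
    (140, 3620610111765535670898005418421041828698388645211253849422434930372),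
    (141, 4584598319360811006309667466240187269286227832466217380888659870564),
    (142, 22463762957396345404895652034603841777373871194573488291314519682778),
    (143, 127811878253595323051282179175649543595180277264588418765281315801616),
    (144, 436108995139404280864794280664763959710835925386466066912505361264280),
    (145, 371350109784696655958377668441905677349446148139003236831084924034942),
    (146, 1114057391604677074533237448249188079816609541460182090749483722856347),
    (147, 1928333855922342688417790515259511766417419089030918477634174300689112),
    (148, 31083315146127569987500947420705299276279439209083339145762299146497094),
    (149, 93167793847061924554869791059939174760683885718196747402038509513682100),
    (150, 156195078545483857093860236109376487899420653929432106243312538628780874),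
    (151, 468585248227590328626747633795118669826031925070929104649270857485660772),
    (152, 634275820527821962574975958055278985105166157569531892112288186177792557),
    (153, 1427069165591554303069349513523007033831140403236905122763715507445564299),
    (154, 25685403488925689408800907955119329110658184808017052728763480236656039608),
    (155, 72781754709284661431177942055456971749356256706834538264601522779943036005),
    (156, 162271469052110557308761232191492110924015483787324293765745847035803214097),
    (157, 217112795995198886334592449684254946062240033403381706735476441720449019162),
    (158, 1402698539978548482966248344107344475779715962507270664830504701458869297409),
    (159, 6242149929230161121139329916201274692589111944481301250480042547224882763827),
    (160, 3122790909412385045214806231085682329033380050354253843778108194242020108213),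
    (161, 26110383178854772446662942329181172829967155460663368386166433109678255079119)]

theorem extremal_of_mem_extremalWords : ∀ p ∈ extremalWords, Check.extremal p.1 p.2 = true := by
  decide +kernel

theorem exists_mem_extremalWords : ∀ n < 162, n ∈ [25, 41, 48, 50, 63, 71, 72, 77, 79, 81, 83, 84,
    85] ∨ 87 ≤ n → ∃ p ∈ extremalWords, p.1 = n := by
  decide +kernel

/-! ### Conclusion -/

theorem fullSearch_eq_true {r : ℕ} (hr : r < 11) : Search.fullSearch 11 r = true := by
  interval_cases r
  exacts [Search.fullSearch_0, Search.fullSearch_1, Search.fullSearch_2, Search.fullSearch_3,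
    Search.fullSearch_4, Search.fullSearch_5, Search.fullSearch_6, Search.fullSearch_7,
    Search.fullSearch_8, Search.fullSearch_9, Search.fullSearch_10]

theorem theorem1 (n : ℕ) :
    (∃ w : List Letter, w.length = n ∧ ExtremalSquareFree w) ↔
      n ∈ ({25, 41, 48, 50, 63, 71, 72, 77, 79, 81, 83, 84, 85} : Set ℕ) ∪ {m : ℕ | 87 ≤ m} := by
  have hmem : n ∈ ({25, 41, 48, 50, 63, 71, 72, 77, 79, 81, 83, 84, 85} : Set ℕ) ∪
      {m : ℕ | 87 ≤ m} ↔
      n ∈ [25, 41, 48, 50, 63, 71, 72, 77, 79, 81, 83, 84, 85] ∨ 87 ≤ n := by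
    simp
  rw [hmem]
  constructor
  · rintro ⟨w, rfl, h⟩
    by_cases hn : w.length ≤ 86
    · have := isLength_of_fullSearch (fun _ => fullSearch_eq_true) h hn
      exact Or.inl (List.contains_iff_mem.1 this)
    · exact Or.inr (by omega)
  · intro h
    obtain ⟨u, hu, h⟩ : ∃ u : List (Fin 3), u.length = n ∧ ExtremalSquareFree u := by
      by_cases hn : n < 162
      · obtain ⟨p, hp, rfl⟩ := exists_mem_extremalWords n hn h
        exact ⟨_, Check.length_decode _ _, Check.extremal_sound (by omega)
          (extremal_of_mem_extremalWords p hp)⟩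
      · exact Morphism.exists_extremalSquareFree (by omega)
    exact ⟨u.map letterEquiv.symm, by simpa, (extremalSquareFree_map letterEquiv.symm u).2 h⟩
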